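/- Conventions. $\|\cdot\|$ is the norm of $L^2(\mathbb R^d)$ (complex-valued functions) and $\Delta=-\sum_j\partial_j^2$ is the positive Laplacian, so $\Delta+\varepsilon$ has symbol $|\xi|^2+\varepsilon$. For $\sigma>0$, $B_\sigma(\mathbb R^d)$ is the set of $f\in L^2(\mathbb R^d)$ whose Fourier transform $\hat f(\xi)=(2\pi)^{-d/2}\int f(x)e^{-ix\cdot\xi}\,dx$ is supported in the closed ball $|\xi|\le\sigma$; such an $f$ is identified with its continuous representative. For $\lambda>0$, a knot set $X(\lambda)$ is a countable set of points $x_\gamma\in\mathbb R^d$ that is uniformly separated (there is $\delta>0$ with $|x_\gamma-x_\mu|\ge\delta$ for $\gamma\ne\mu$) and for which there are pairwise disjoint open sets $Q(x_\gamma,\lambda)\subset\mathbb R^d$ of diameter $\le\lambda$ such that $Q(x_\gamma,\lambda)$ contains $x_\gamma$ and no other knot, each closure $\overline{Q(x_\gamma,\lambda)}$ is homeomorphic to a closed ball, and these closures cover $\mathbb R^d$. For $\varepsilon>0$ and an integer $k>d/2$, let $$E_\varepsilon^k(x)=(2\pi)^{-d}\int_{\mathbb R^d}\frac{e^{i\xi\cdot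 x}}{(|\xi|^2+\varepsilon)^k}\,d\xi$$ be the fundamental solution of $(\Delta+\varepsilon)^k$, and let $S^k(X(\lambda))$ be the space of $u\in L^2(\mathbb R^d)$ (identified with their continuous representatives) satisfying, as tempered distributions, $(\Delta+\varepsilon)^k u=\sum_\gamma\alpha_\gamma\,\delta(x_\gamma)$ for some $(\alpha_\gamma)\in\ell^2$. The Lagrangian spline $L_\nu^k$ is the element of $S^k(X(\lambda))$ with $L_\nu^k(x_\nu)=1$ and $L_\nu^k(x_\mu)=0$ for all $\mu\neq\nu$. **Theorem 2.1.** For every dimension $d$ and every $\varepsilon>0$ there is a constant $c=c(d,\varepsilon)>0$, depending only on $d$ and $\varepsilon$, such that the following holds for every $\sigma>0$, every $\lambda>0$ with $\lambda<\big((\sigma+\varepsilon)\,c(d,\varepsilon)\big)^{-1}$, every knot set $X(\lambda)$ and every integer $r\ge[d/2]+1$. For every integer $l\ge0$ and every knot $x_\nu$ the Lagrangian spline $L_\nu^{2^l r}$ exists and is unique, and it is a linear combination $L_\nu^{2^l r}(x)=\sum_\mu a_\mu E_\varepsilon^{2^l r}(x-x_\mu)$, $x\in\mathbb R^d$, of translates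 of the fundamental solution, with $(a_\mu)\in\ell^2$. For every $f\in B_\sigma(\mathbb R^d)$ the series $\sum_\nu f(x_\nu)L_\nu^{2^l r}$ converges unconditionally in $L^2(\mathbb R^d)$ for every $l\ge0$, $$f=\lim_{l\to\infty}\sum_{x_\nu\in X(\lambda)}f(x_\nu)\,L_\nu^{2^l r}\quad\text{in }L^2(\mathbb R^d),$$ and for every $l\ge 0$ $$\Big\|f-\sum_\nu f(x_\nu)L_\nu^{2^l r}\Big\|\le 2\big(c(d,\varepsilon)\,\lambda\,(\sigma+\varepsilon)\big)^{2^{l+1}r}\,\|f\|.$$ -/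

import Mathlib

open MeasureTheory Filter Topology
open scoped ENNReal FourierTransform SchwartzMap Laplacian

namespace IrregularSampling

noncomputable section

/-- The Euclidean space `ℝ^d`. -/
abbrev E (d : ℕ) : Type := EuclideanSpace ℝ (Fin d)

/-- The Hilbert space `L²(ℝ^d)` of complex-valued functions. -/
abbrev L2 (d : ℕ) : Type := Lp ℂ 2 (volume : Measure (E d))

/-- Knot sets `X(lam)`: a countable set `X ⊆ ℝ^d` of points, any two of which have distance at
least some fixed `δ > 0`, together with cells: pairwise disjoint open sets `Q γ` (`γ ∈ X`) of
diameter at most `lam`, each containing the point `γ` and no other point of `X`, whose closures are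
topological closed balls and cover `ℝ^d`. -/
structure IsKnotSet {d : ℕ} (lam : ℝ) (X : Set (E d)) : Prop where
  countable : X.Countable
  separated : ∃ δ : ℝ, 0 < δ ∧ ∀ x ∈ X, ∀ y ∈ X, x ≠ y → δ ≤ dist x y
  exists_cells : ∃ Q : X → Set (E d),
    (∀ γ, IsOpen (Q γ)) ∧
    (∀ γ, Q γ ∩ X = {(γ : E d)}) ∧
    (∀ γ, Nonempty (closure (Q γ) ≃ₜ Metric.closedBall (0 : E d) 1)) ∧
    (∀ γ, Metric.ediam (Q γ) ≤ ENNReal.ofReal lam) ∧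
    (∀ γ μ, γ ≠ μ → Disjoint (Q γ) (Q μ)) ∧
    (⋃ γ, closure (Q γ)) = Set.univ

/-- The space `B_σ(ℝ^d)`: functions in `L²(ℝ^d)` (given by their continuous representative, so that
point values make sense) whose Fourier transform
`(2π)^(-d/2) ∫ f x * exp (-i x ξ) dx` is supported in the ball `|ξ| ≤ σ`.
Mathlib's Fourier transform (Plancherel extension to `L²`) uses the kernel `exp (-2 π i x w)`, that
is, `ξ = 2 π w`. -/
structure IsBandLimited {d : ℕ} (σ : ℝ) (f : E d → ℂ) : Prop where
  continuous : Continuous f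
  memLp : MemLp f 2 (volume : Measure (E d))
  fourier_eq_zero : ∀ᵐ w ∂(volume : Measure (E d)),
    σ < 2 * Real.pi * ‖w‖ → (𝓕 (memLp.toLp f : L2 d) : L2 d) w = 0

/-- The operator `D = Δ + ε` on tempered distributions, where `Δ` is the positive Laplacian
`-∑ ∂ⱼ²` (Mathlib's `Δ` is `∑ ∂ⱼ²`), so that `D` has the symbol `|ξ|² + ε`. -/
def opD {d : ℕ} (ε : ℝ) (T : 𝓢'(E d, ℂ)) : 𝓢'(E d, ℂ) :=
  (ε : ℂ) • T - Δ T

/-- The fundamental solution of `(Δ + ε)^k` for `k > d / 2`: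
`(2π)^(-d) ∫ exp (i ξ x) / (|ξ|² + ε)^k dξ`. -/
def fundamentalSolution {d : ℕ} (ε : ℝ) (k : ℕ) (x : E d) : ℂ :=
  ((2 * Real.pi : ℝ) : ℂ)⁻¹ ^ d *
    ∫ ξ : E d, Complex.exp (Complex.I * ((inner ℝ ξ x : ℝ) : ℂ)) / (((‖ξ‖ ^ 2 + ε) ^ k : ℝ) : ℂ)

/-- The spline space `S^k(X)`: the solutions `u ∈ L²(ℝ^d)` (given by their continuous
representative) of `(Δ + ε)^k u = ∑_γ α_γ δ(x_γ)` with `α ∈ ℓ²(X)`, as an equation between tempered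
distributions. -/
structure IsSpline {d : ℕ} (ε : ℝ) (X : Set (E d)) (k : ℕ) (u : E d → ℂ) : Prop where
  continuous : Continuous u
  memLp : MemLp u 2 (volume : Measure (E d))
  equation : ∃ α : lp (fun _ : X => ℂ) 2,
    HasSum (fun γ : X => α γ • TemperedDistribution.delta (γ : E d))
      ((opD ε)^[k] ((memLp.toLp u : L2 d) : 𝓢'(E d, ℂ)))

open Classical in
/-- `u` is a Lagrangian spline `L_ν^k`: an element of `S^k(X)` with value `1` at the knot `ν` and
`0` at all other knots. -/
structure IsLagrangianSpline {d : ℕ} (ε : ℝ) (X : Set (E d)) (k : ℕ) (ν : X) (u : E d → ℂ) : Prop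
    extends IsSpline ε X k u where
  apply_knot : ∀ μ : X, u μ = if μ = ν then 1 else 0

end

end IrregularSampling

open IrregularSampling

/-!
Throughout, a function of the Sobolev space of order `k` is written as `u = 𝓕⁻ (m^(-k/2) g)` with
`g ∈ L²`, where `m` is the symbol of `Δ + ε` (`besselPotential`). Evaluation at a point `x` is then
the inner product with a vector `e_x` of `L²` (`besselEval`), and `⟪e_x, e_y⟫` is the fundamental
solution at `x - y`.

The analytic core is a local Sobolev inequality (`exists_oscillation_bound`): the square of the
oscillation of `u = 𝓕⁻ F` over the unit ball about `x`, integrated over `x`, is at most a constant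
times a weighted `L²` norm of `F`. It comes from Fourier inversion, in the variable `y`, of
`exp (-π ‖y‖²) (u (x + y) - u x)`, from the Cauchy-Schwarz inequality with the weight
`(1 + ‖ξ‖²)^s`, `s > d / 2`, and from Plancherel in `x`. It has two consequences.

* If `u` vanishes on a `λ`-dense set, then `‖u‖` is at most the `L²` norm of the oscillation at
  scale `λ`. The weight is small at low frequencies, and the low frequency part is absorbed. What
  remains gives `‖u‖ ≤ (c λ)^k ‖(Δ + ε)^(k/2) u‖` for all `k ≥ s` with one constant `c`
  (`exists_norm_besselMul_le`).
* On a separated set, the values of `u` are square summable (`exists_bessel_bound`).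

Comparison with the Fourier transform of a bump function shows that the vectors `e_γ`, `γ ∈ X`,
also have a lower Riesz bound (`exists_riesz_lower_bound`), so that their Gram operator is
invertible on `ℓ²`. As `(Δ + ε)^k` is injective on tempered distributions and maps the Bessel
potential of `e_γ` to `δ(γ)`, the splines are exactly the Bessel potentials of the sums
`∑ α_γ e_γ` with `α ∈ ℓ²`; this gives the Lagrangian splines, and interpolation becomes the
orthogonal projection to the span of the `e_γ` (`exists_lagrangianSplines`).

If `f` has density `g` and its interpolant has density `p`, then `g - p` is orthogonal to `p`, and
hence `‖g - p‖² = ⟪g - p, g⟫ ≤ ‖f - s‖ ‖(Δ + ε)^k f‖`. Together with the sampling inequality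
`‖f - s‖ ≤ (c λ)^k ‖g - p‖` this is `‖f - s‖ ≤ (c λ)^(2k) ‖(Δ + ε)^k f‖` (`norm_besselMul_sub_le`),
and `(Δ + ε)^k` is bounded by `(σ² + ε)^k` on band-limited functions.
-/

namespace IrregularSampling

variable {d : ℕ} {ε : ℝ}

/-! ### The Fourier transform on the intersection of `L¹` and `L²` -/

lemma integral_fourierInv_smul_eq {F φ : E d → ℂ} (hF : Integrable F) (hφ : Integrable φ) :
    ∫ x, 𝓕⁻ F x * φ x = ∫ ξ, F ξ * 𝓕⁻ φ ξ := by
  have := VectorFourier.integral_fourierIntegral_smul_eq_flip (e := Real.fourierChar)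
    (μ := (volume : Measure (E d))) (ν := (volume : Measure (E d))) (L := -innerₗ (E d))
    Real.continuous_fourierChar (by
      simp only [LinearMap.neg_apply, innerₗ_apply_apply]
      fun_prop) hF hφ
  simp only [smul_eq_mul] at this
  have hflip : (-innerₗ (E d)).flip = -innerₗ (E d) := by
    ext v w
    simp [real_inner_comm]
  rw [hflip] at this
  exact this

lemma continuous_fourierInv {F : E d → ℂ} (hF : Integrable F) : Continuous (𝓕⁻ F) := by
  rw [Real.fourierInv_eq_fourier_comp_neg]
  exact VectorFourier.fourierIntegral_continuous Real.continuous_fourierChar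
    (by simp only [innerₗ_apply_apply]; fun_prop) hF.comp_neg

/-- On `L¹ ∩ L²` the Fourier integral agrees with the Plancherel extension. -/
lemma exists_toLp_fourierInv {F : E d → ℂ} (h1 : Integrable F) (h2 : MemLp F 2) :
    ∃ h : MemLp (𝓕⁻ F) 2, h.toLp (𝓕⁻ F) = (𝓕⁻ (h2.toLp F : L2 d) : L2 d) := by
  set u : L2 d := 𝓕⁻ (h2.toLp F : L2 d) with hu
  have hcont := continuous_fourierInv h1
  have hae : u =ᵐ[volume] 𝓕⁻ F := by
    refine ae_eq_of_integral_contDiff_smul_eq ((Lp.memLp u).locallyIntegrable (by norm_num))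
      hcont.locallyIntegrable fun g hg hgc => ?_
    have hg1 : HasCompactSupport (Complex.ofRealCLM ∘ g) := hgc.comp_left rfl
    have hg2 : ContDiff ℝ (↑(⊤ : ℕ∞)) (Complex.ofRealCLM ∘ g) := by fun_prop
    set φ : 𝓢(E d, ℂ) := hg1.toSchwartzMap hg2 with hφ
    have hφg : ∀ x, φ x = (g x : ℂ) := fun x => by simp [hφ]
    have e1 : (u : 𝓢'(E d, ℂ)) φ = ∫ x, g x • u x := by
      rw [Lp.toTemperedDistribution_apply]
      simp [hφg]
    rw [← e1, hu, ← Lp.fourierInv_toTemperedDistribution_eq, TemperedDistribution.fourierInv_apply,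
      Lp.toTemperedDistribution_apply]
    have e2 : ∫ x, (𝓕⁻ φ : 𝓢(E d, ℂ)) x • (h2.toLp F) x = ∫ x, F x * 𝓕⁻ (φ : E d → ℂ) x := by
      refine integral_congr_ae ?_
      filter_upwards [h2.coeFn_toLp] with x hx
      rw [hx, SchwartzMap.fourierInv_coe, smul_eq_mul, mul_comm]
    rw [e2, ← integral_fourierInv_smul_eq h1 φ.integrable]
    refine integral_congr_ae (Eventually.of_forall fun x => ?_)
    simp [hφg, mul_comm]
  have h : MemLp (𝓕⁻ F) 2 := (memLp_congr_ae hae).1 (Lp.memLp u)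
  refine ⟨h, ?_⟩
  refine Lp.ext (h.coeFn_toLp.trans hae.symm)

lemma lintegral_enorm_sq (g : L2 d) : ∫⁻ x, ‖g x‖ₑ ^ 2 = ‖g‖ₑ ^ 2 := by
  rw [Lp.enorm_def, eLpNorm_eq_lintegral_rpow_enorm_toReal (by norm_num) (by norm_num)]
  simp [← ENNReal.rpow_mul_natCast]

lemma lintegral_enorm_sq_toLp {f : E d → ℂ} (hf : MemLp f 2) :
    ∫⁻ x, ‖f x‖ₑ ^ 2 = ‖hf.toLp f‖ₑ ^ 2 := by
  rw [← lintegral_enorm_sq]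
  refine lintegral_congr_ae ?_
  filter_upwards [hf.coeFn_toLp] with x hx
  rw [hx]

lemma lintegral_fourierInv_sq {F : E d → ℂ} (h1 : Integrable F) (h2 : MemLp F 2) :
    ∫⁻ x, ‖𝓕⁻ F x‖ₑ ^ 2 = ∫⁻ ξ, ‖F ξ‖ₑ ^ 2 := by
  obtain ⟨h, he⟩ := exists_toLp_fourierInv h1 h2
  rw [lintegral_enorm_sq_toLp h, lintegral_enorm_sq_toLp h2, he]
  congr 1
  rw [enorm_eq_iff_norm_eq]
  exact (Lp.fourierTransformₗᵢ (E d) ℂ).symm.norm_map _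

lemma sq_lintegral_mul_le {α : Type*} [MeasurableSpace α] {μ : Measure α} {f g : α → ℝ≥0∞}
    (hf : AEMeasurable f μ) (hg : AEMeasurable g μ) :
    (∫⁻ x, f x * g x ∂μ) ^ 2 ≤ (∫⁻ x, f x ^ 2 ∂μ) * ∫⁻ x, g x ^ 2 ∂μ := by
  have h := ENNReal.lintegral_mul_le_Lp_mul_Lq μ Real.HolderConjugate.two_two hf hg
  calc _ ≤ _ := pow_le_pow_left' h 2
    _ = _ := by
      rw [mul_pow]
      simp [← ENNReal.rpow_mul_natCast]

/-! ### A local Sobolev inequality -/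

/-- The Gaussian `exp (-π ‖x‖²)`, which is its own Fourier transform. -/
noncomputable def gauss (x : E d) : ℝ := Real.exp (-(Real.pi * ‖x‖ ^ 2))

lemma gauss_pos (x : E d) : 0 < gauss x := Real.exp_pos _

lemma gauss_le_one (x : E d) : gauss x ≤ 1 := by
  simp only [gauss, Real.exp_le_one_iff, Left.neg_nonpos_iff]
  positivity

@[fun_prop]
lemma continuous_gauss : Continuous (gauss : E d → ℝ) := by
  unfold gauss
  fun_prop

lemma integrable_gauss : Integrable (fun x : E d => (gauss x : ℂ)) := by
  have := GaussianFourier.integrable_cexp_neg_mul_sq_norm_add (V := E d) (b := Real.pi)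
    (by simpa using Real.pi_pos) 0 0
  refine this.congr (Eventually.of_forall fun x => ?_)
  simp [gauss]

lemma fourierInv_gauss (y : E d) : 𝓕⁻ (fun x : E d => (gauss x : ℂ)) y = gauss y := by
  have h := fourier_gaussian_innerProductSpace (V := E d) (b := Real.pi)
    (by simpa using Real.pi_pos) (-y)
  have hpi : (Real.pi : ℂ) ≠ 0 := by exact_mod_cast Real.pi_ne_zero
  rw [Real.fourierInv_eq_fourier_neg]
  convert h using 2
  · ext x
    simp [gauss]
  · rw [div_self hpi, Complex.one_cpow, one_mul]
    simp only [gauss, norm_neg]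
    push_cast
    congr 1
    field_simp

lemma integral_circle_smul {α : Type*} [MeasurableSpace α] {μ : Measure α} (c : Circle)
    (f : α → ℂ) : ∫ x, c • f x ∂μ = c • ∫ x, f x ∂μ := by
  simp only [Circle.smul_def]
  exact integral_smul _ _

lemma integral_char_smul_gauss_sub (y η : E d) :
    ∫ ξ : E d, Real.fourierChar (inner ℝ ξ y) • (gauss (ξ - η) : ℂ) =
      Real.fourierChar (inner ℝ η y) • (gauss y : ℂ) := by
  rw [← integral_add_right_eq_self _ η]
  simp only [add_sub_cancel_right, inner_add_left, AddChar.map_add_eq_mul, mul_smul]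
  simp_rw [smul_comm _ (Real.fourierChar (inner ℝ η y))]
  rw [integral_circle_smul, ← Real.fourierInv_eq, fourierInv_gauss]

/-- The inverse Fourier transform of a function cut off by the difference of two Gaussians; as a
function of `ξ`, it is the Fourier transform of `y ↦ gauss y * (f (x + y) - f x)`, where `f` is the
inverse Fourier transform of `F`. -/
noncomputable def windowed (F : E d → ℂ) (ξ x : E d) : ℂ :=
  𝓕⁻ (fun η => F η * ((gauss (ξ - η) - gauss ξ : ℝ) : ℂ)) x

lemma integrable_char_smul {F : E d → ℂ} (hF : Integrable F) (x y : E d) :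
    Integrable (fun p : E d × E d => Real.fourierChar (inner ℝ p.1 y) •
      Real.fourierChar (inner ℝ p.2 x) • (F p.2 * ((gauss (p.1 - p.2) - gauss p.1 : ℝ) : ℂ)))
      (volume.prod volume) := by
  have h1 : Integrable (fun p : E d × E d => F p.2 * (gauss (p.1 - p.2) : ℂ))
      (volume.prod volume) :=
    hF.convolution_integrand (ContinuousLinearMap.mul ℂ ℂ) integrable_gauss
  have h2 : Integrable (fun p : E d × E d => F p.2 * (gauss p.1 : ℂ)) (volume.prod volume) := by
    simpa [mul_comm] using integrable_gauss.mul_prod hF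
  have h3 := h1.sub h2
  refine (h3.congr (g := fun p : E d × E d => F p.2 * ((gauss (p.1 - p.2) - gauss p.1 : ℝ) : ℂ))
    (Eventually.of_forall fun p => by simp [mul_sub])).mono ?_ ?_
  · refine AEStronglyMeasurable.smul (Continuous.aestronglyMeasurable (by fun_prop)) ?_
    refine AEStronglyMeasurable.smul (Continuous.aestronglyMeasurable (by fun_prop)) ?_
    exact hF.aestronglyMeasurable.comp_snd.mul (Continuous.aestronglyMeasurable (by fun_prop))
  · exact Eventually.of_forall fun p => by simp [Circle.norm_smul]

/-- Fourier inversion in `y`: the windowed transforms recover the increments of `𝓕⁻ F`. -/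
lemma integral_windowed {F : E d → ℂ} (hF : Integrable F) (x y : E d) :
    ∫ ξ, Real.fourierChar (inner ℝ ξ y) • windowed F ξ x =
      gauss y * (𝓕⁻ F (x + y) - 𝓕⁻ F x) := by
  have hG := integrable_gauss (d := d)
  have hint : ∀ z : E d, Integrable (fun η => Real.fourierChar (inner ℝ η z) • F η) := fun z => by
    have := (Real.fourierIntegral_convergent_iff (μ := volume) (f := F) (-z)).2 hF
    simpa using this
  have hin : ∀ η, ∫ ξ : E d, Real.fourierChar (inner ℝ ξ y) •
      Real.fourierChar (inner ℝ η x) • (F η * ((gauss (ξ - η) - gauss ξ : ℝ) : ℂ)) =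
      gauss y * (Real.fourierChar (inner ℝ η (x + y)) • F η -
        Real.fourierChar (inner ℝ η x) • F η) := by
    intro η
    have i1 : Integrable fun ξ : E d => Real.fourierChar (inner ℝ ξ y) • (gauss (ξ - η) : ℂ) := by
      have := (Real.fourierIntegral_convergent_iff (μ := volume)
        (f := fun ξ : E d => (gauss (ξ - η) : ℂ)) (-y)).2 (hG.comp_sub_right η)
      simpa using this
    have i2 : Integrable fun ξ : E d => Real.fourierChar (inner ℝ ξ y) • (gauss ξ : ℂ) := by
      have := (Real.fourierIntegral_convergent_iff (μ := volume)
        (f := fun ξ : E d => (gauss ξ : ℂ)) (-y)).2 hG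
      simpa using this
    have : ∀ ξ : E d, Real.fourierChar (inner ℝ ξ y) •
      Real.fourierChar (inner ℝ η x) • (F η * ((gauss (ξ - η) - gauss ξ : ℝ) : ℂ)) =
      (Real.fourierChar (inner ℝ η x) • F η) * (Real.fourierChar (inner ℝ ξ y) •
        (gauss (ξ - η) : ℂ) - Real.fourierChar (inner ℝ ξ y) • (gauss ξ : ℂ)) := by
      intro ξ
      simp only [Circle.smul_def, smul_eq_mul]
      push_cast
      ring
    simp_rw [this]
    rw [integral_const_mul, integral_sub i1 i2, integral_char_smul_gauss_sub]
    have := integral_char_smul_gauss_sub y (0 : E d)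
    simp only [sub_zero, inner_zero_left, AddChar.map_zero_eq_one, one_smul] at this
    rw [this, inner_add_right, AddChar.map_add_eq_mul]
    simp only [Circle.smul_def, smul_eq_mul, Circle.coe_mul]
    ring
  calc _ = ∫ ξ : E d, ∫ η : E d, Real.fourierChar (inner ℝ ξ y) •
      Real.fourierChar (inner ℝ η x) • (F η * ((gauss (ξ - η) - gauss ξ : ℝ) : ℂ)) := by
        simp_rw [integral_circle_smul, windowed, Real.fourierInv_eq]
    _ = ∫ η : E d, ∫ ξ : E d, Real.fourierChar (inner ℝ ξ y) •
      Real.fourierChar (inner ℝ η x) • (F η * ((gauss (ξ - η) - gauss ξ : ℝ) : ℂ)) :=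
        integral_integral_swap (integrable_char_smul hF x y)
    _ = _ := by
        simp_rw [hin]
        rw [integral_const_mul, integral_sub (hint _) (hint _), ← Real.fourierInv_eq,
          ← Real.fourierInv_eq]

lemma measurable_windowed {F : E d → ℂ} (hF : StronglyMeasurable F) :
    Measurable (fun p : E d × E d => windowed F p.1 p.2) := by
  simp only [windowed, Real.fourierInv_eq]
  refine StronglyMeasurable.measurable ?_
  refine StronglyMeasurable.integral_prod_right (f := fun (p : E d × E d) (η : E d) =>
    Real.fourierChar (inner ℝ η p.2) • (F η * ((gauss (p.1 - η) - gauss p.1 : ℝ) : ℂ))) ?_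
  refine StronglyMeasurable.smul (Continuous.stronglyMeasurable (by fun_prop)) ?_
  exact (hF.comp_measurable measurable_snd).mul (Continuous.stronglyMeasurable (by fun_prop))

lemma lintegral_windowed_sq {F : E d → ℂ} (h1 : Integrable F) (h2 : MemLp F 2) (ξ : E d) :
    ∫⁻ x, ‖windowed F ξ x‖ₑ ^ 2 =
      ∫⁻ η, ‖F η‖ₑ ^ 2 * ‖gauss (ξ - η) - gauss ξ‖ₑ ^ 2 := by
  have hb : ∀ η, ‖((gauss (ξ - η) - gauss ξ : ℝ) : ℂ)‖ ≤ 1 := fun η => by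
    rw [Complex.norm_real, Real.norm_eq_abs, abs_le]
    constructor <;> linarith [gauss_pos ξ, gauss_pos (ξ - η), gauss_le_one ξ, gauss_le_one (ξ - η)]
  have hm : AEStronglyMeasurable (fun η : E d => ((gauss (ξ - η) - gauss ξ : ℝ) : ℂ)) :=
    Continuous.aestronglyMeasurable (by fun_prop)
  have i1 : Integrable (fun η => F η * ((gauss (ξ - η) - gauss ξ : ℝ) : ℂ)) :=
    h1.mul_bdd (c := 1) hm (Eventually.of_forall hb)
  have i2 : MemLp (fun η => F η * ((gauss (ξ - η) - gauss ξ : ℝ) : ℂ)) 2 := by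
    refine h2.mono (h1.aestronglyMeasurable.mul hm) (Eventually.of_forall fun η => ?_)
    rw [norm_mul]
    exact mul_le_of_le_one_right (norm_nonneg _) (hb η)
  unfold windowed
  rw [lintegral_fourierInv_sq i1 i2]
  refine lintegral_congr fun η => ?_
  rw [enorm_mul, mul_pow]
  congr 2
  exact enorm_eq_iff_norm_eq.2 (Complex.norm_real _)

/-- The Sobolev weight `(1 + ‖ξ‖²)^s`. -/
noncomputable def sobolevWeight (s : ℕ) (ξ : E d) : ℝ≥0∞ := ENNReal.ofReal ((1 + ‖ξ‖ ^ 2) ^ s)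

/-- The Fourier weight that governs the local oscillation of a function, see
`exists_oscillation_bound`. -/
noncomputable def oscWeight (s : ℕ) (η : E d) : ℝ≥0∞ :=
  ∫⁻ ξ, ‖gauss (ξ - η) - gauss ξ‖ₑ ^ 2 * sobolevWeight s ξ

@[fun_prop]
lemma measurable_sobolevWeight (s : ℕ) : Measurable (sobolevWeight s : E d → ℝ≥0∞) := by
  unfold sobolevWeight
  fun_prop

lemma sobolevWeight_ne_top (s : ℕ) (ξ : E d) : sobolevWeight s ξ ≠ ∞ := ENNReal.ofReal_ne_top

lemma sobolevWeight_ne_zero (s : ℕ) (ξ : E d) : sobolevWeight s ξ ≠ 0 := by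
  simp only [sobolevWeight, ne_eq, ENNReal.ofReal_eq_zero, not_le]
  positivity

lemma integrable_inv_one_add_norm_sq_pow {s : ℕ} (hs : d < 2 * s) :
    Integrable (fun ξ : E d => ((1 + ‖ξ‖ ^ 2) ^ s)⁻¹) := by
  have := integrable_rpow_neg_one_add_norm_sq (E := E d) (μ := volume) (r := 2 * s)
    (by simpa using by exact_mod_cast hs)
  refine this.congr (Eventually.of_forall fun x => ?_)
  have : (-(2 * (s : ℝ)) / 2) = -(s : ℝ) := by ring
  simp only [this]
  rw [Real.rpow_neg (by positivity), Real.rpow_natCast]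

lemma lintegral_inv_sobolevWeight_lt_top {s : ℕ} (hs : d < 2 * s) :
    ∫⁻ ξ : E d, (sobolevWeight s ξ)⁻¹ < ∞ := by
  have := (integrable_inv_one_add_norm_sq_pow hs).lintegral_lt_top
  refine lt_of_eq_of_lt (lintegral_congr fun ξ => ?_) this
  rw [sobolevWeight, ENNReal.ofReal_inv_of_pos (by positivity)]

lemma enorm_oscillation_le {F : E d → ℂ} (h1 : Integrable F) (x y : E d) (hy : ‖y‖ ≤ 1) :
    ‖𝓕⁻ F (x + y) - 𝓕⁻ F x‖ₑ ≤
      ENNReal.ofReal (Real.exp Real.pi) * ∫⁻ ξ, ‖windowed F ξ x‖ₑ := by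
  -- on the unit ball the Gaussian window is at least `exp (-π)`
  have hg : (1 : ℝ) ≤ Real.exp Real.pi * gauss y := by
    rw [gauss, ← Real.exp_add, Real.one_le_exp_iff]
    have : ‖y‖ ^ 2 ≤ 1 := pow_le_one₀ (norm_nonneg _) hy
    nlinarith [Real.pi_pos]
  calc ‖𝓕⁻ F (x + y) - 𝓕⁻ F x‖ₑ
      ≤ ENNReal.ofReal (Real.exp Real.pi) * ‖(gauss y : ℂ) * (𝓕⁻ F (x + y) - 𝓕⁻ F x)‖ₑ := by
        rw [← ofReal_norm, ← ofReal_norm, ← ENNReal.ofReal_mul (Real.exp_pos _).le]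
        refine ENNReal.ofReal_le_ofReal ?_
        rw [norm_mul, Complex.norm_real, Real.norm_of_nonneg (gauss_pos y).le, ← mul_assoc]
        exact le_mul_of_one_le_left (norm_nonneg _) hg
    _ ≤ _ := by
        rw [← integral_windowed h1]
        refine mul_le_mul_right ((enorm_integral_le_lintegral_enorm _).trans_eq
          (lintegral_congr fun ξ => ?_)) _
        exact enorm_eq_iff_norm_eq.2 (Circle.norm_smul _ _)

lemma sq_lintegral_le_mul_sobolevWeight (s : ℕ) {f : E d → ℝ≥0∞} (hf : Measurable f) :
    (∫⁻ ξ, f ξ) ^ 2 ≤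
      (∫⁻ ξ : E d, (sobolevWeight s ξ)⁻¹) * ∫⁻ ξ, f ξ ^ 2 * sobolevWeight s ξ := by
  have := sq_lintegral_mul_le (μ := (volume : Measure (E d)))
    (f := fun ξ => (sobolevWeight s ξ)⁻¹ ^ (1 / 2 : ℝ))
    (g := fun ξ => f ξ * sobolevWeight s ξ ^ (1 / 2 : ℝ))
    (by fun_prop) (by fun_prop)
  refine le_trans (le_of_eq ?_) (this.trans_eq ?_)
  · congr 1
    refine lintegral_congr fun ξ => ?_
    rw [mul_left_comm, ← ENNReal.mul_rpow_of_nonneg _ _ (by norm_num),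
      ENNReal.inv_mul_cancel (sobolevWeight_ne_zero _ _) (sobolevWeight_ne_top _ _)]
    simp
  · congr 1
    · refine lintegral_congr fun ξ => ?_
      rw [← ENNReal.rpow_mul_natCast]
      simp
    · refine lintegral_congr fun ξ => ?_
      rw [mul_pow, ← ENNReal.rpow_mul_natCast]
      simp

lemma lintegral_windowed_sq_mul {F : E d → ℂ} (hF : StronglyMeasurable F) (h1 : Integrable F)
    (h2 : MemLp F 2) (s : ℕ) :
    ∫⁻ x, ∫⁻ ξ, ‖windowed F ξ x‖ₑ ^ 2 * sobolevWeight s ξ =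
      ∫⁻ η, ‖F η‖ₑ ^ 2 * oscWeight s η := by
  have hM : Measurable fun p : E d × E d => ‖windowed F p.2 p.1‖ₑ ^ 2 * sobolevWeight s p.2 :=
    (((measurable_windowed hF).comp measurable_swap).enorm.pow_const 2).mul
      ((measurable_sobolevWeight s).comp measurable_snd)
  rw [lintegral_lintegral_swap hM.aemeasurable]
  have : ∀ ξ, ∫⁻ x, ‖windowed F ξ x‖ₑ ^ 2 * sobolevWeight s ξ =
      ∫⁻ η, ‖F η‖ₑ ^ 2 * (‖gauss (ξ - η) - gauss ξ‖ₑ ^ 2 * sobolevWeight s ξ) := fun ξ => by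
    rw [lintegral_mul_const' _ _ (sobolevWeight_ne_top _ _), lintegral_windowed_sq h1 h2,
      ← lintegral_mul_const' _ _ (sobolevWeight_ne_top _ _)]
    simp_rw [mul_assoc]
  simp_rw [this]
  rw [lintegral_lintegral_swap]
  · refine lintegral_congr fun η => ?_
    rw [lintegral_const_mul' _ _ (by simp), oscWeight]
  · refine Measurable.aemeasurable ?_
    refine ((hF.measurable.comp measurable_snd).enorm.pow_const 2).mul
      (Measurable.mul ?_ ((measurable_sobolevWeight s).comp measurable_fst))
    exact (Continuous.measurable (f := fun p : E d × E d => gauss (p.1 - p.2) - gauss p.1)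
      (by fun_prop)).enorm.pow_const 2

/-- Local Sobolev inequality in amalgam form: the oscillation of `f = 𝓕⁻ F` over the unit ball
about `x` is dominated by a function of `x` whose integral is controlled by a weighted `L²` norm
of `F`. -/
lemma exists_oscillation_bound {s : ℕ} (hs : d < 2 * s) :
    ∃ C : ℝ≥0∞, C ≠ ∞ ∧ ∀ F : E d → ℂ, StronglyMeasurable F → Integrable F → MemLp F 2 →
      ∃ M : E d → ℝ≥0∞, Measurable M ∧
        (∀ x y : E d, ‖y‖ ≤ 1 → ‖𝓕⁻ F (x + y) - 𝓕⁻ F x‖ₑ ^ 2 ≤ M x) ∧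
        ∫⁻ x, M x ≤ C * ∫⁻ η, ‖F η‖ₑ ^ 2 * oscWeight s η := by
  set A : ℝ≥0∞ := ENNReal.ofReal (Real.exp Real.pi) ^ 2 * ∫⁻ ξ : E d, (sobolevWeight s ξ)⁻¹
    with hA
  refine ⟨A, ENNReal.mul_ne_top (by simp) (lintegral_inv_sobolevWeight_lt_top hs).ne,
    fun F hF h1 h2 => ?_⟩
  have hW := measurable_windowed hF
  have hM : Measurable fun p : E d × E d => ‖windowed F p.2 p.1‖ₑ ^ 2 * sobolevWeight s p.2 :=
    ((hW.comp measurable_swap).enorm.pow_const 2).mul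
      ((measurable_sobolevWeight s).comp measurable_snd)
  refine ⟨fun x => A * ∫⁻ ξ, ‖windowed F ξ x‖ₑ ^ 2 * sobolevWeight s ξ,
    (hM.lintegral_prod_right').const_mul A, fun x y hy => ?_, ?_⟩
  · have hWξ : Measurable fun ξ => ‖windowed F ξ x‖ₑ :=
      (hW.comp (measurable_id.prodMk measurable_const)).enorm
    calc _ ≤ _ := pow_le_pow_left' (enorm_oscillation_le h1 x y hy) 2
      _ ≤ _ := by
        rw [mul_pow, hA]
        beta_reduce
        rw [mul_assoc]
        exact mul_le_mul_right (sq_lintegral_le_mul_sobolevWeight s hWξ) _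
  · rw [lintegral_const_mul _ hM.lintegral_prod_right', lintegral_windowed_sq_mul hF h1 h2]

/-! ### The sampling inequality -/

lemma lintegral_exp_mul_sobolevWeight_lt_top {b : ℝ} (hb : 0 < b) (s : ℕ) :
    ∫⁻ ξ : E d, ENNReal.ofReal (Real.exp (-(b * ‖ξ‖ ^ 2))) * sobolevWeight s ξ < ∞ := by
  set c : ℝ := b / 2 with hc
  have hc0 : 0 < c := by positivity
  set K : ℝ := s.factorial * (c ^ s)⁻¹ * Real.exp c with hK
  have hint : Integrable (fun ξ : E d => K * Real.exp (-(c * ‖ξ‖ ^ 2))) := by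
    have := GaussianFourier.integrable_cexp_neg_mul_sq_norm_add (V := E d) (b := c)
      (by simpa using hc0) 0 0
    refine (this.norm.congr (Eventually.of_forall fun x => ?_)).const_mul K
    simp [Complex.norm_exp, ← Complex.ofReal_pow]
  refine lt_of_le_of_lt (lintegral_mono fun ξ => ?_) hint.lintegral_lt_top
  rw [sobolevWeight, ← ENNReal.ofReal_mul (Real.exp_pos _).le]
  refine ENNReal.ofReal_le_ofReal ?_
  set t := ‖ξ‖ ^ 2
  have ht : 0 ≤ t := by positivity
  have h1 := Real.pow_div_factorial_le_exp (c * (1 + t)) (by positivity) s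
  have h2 : (1 + t) ^ s ≤ K * Real.exp (c * t) := by
    rw [div_le_iff₀ (by positivity), mul_pow, mul_add, mul_one, Real.exp_add] at h1
    calc (1 + t) ^ s = (c ^ s)⁻¹ * (c ^ s * (1 + t) ^ s) := by field_simp
      _ ≤ (c ^ s)⁻¹ * (Real.exp c * Real.exp (c * t) * s.factorial) := by gcongr
      _ = _ := by rw [hK]; ring
  calc Real.exp (-(b * t)) * (1 + t) ^ s ≤ Real.exp (-(b * t)) * (K * Real.exp (c * t)) := by
        gcongr
    _ = K * (Real.exp (-(b * t)) * Real.exp (c * t)) := by ring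
    _ = _ := by
        rw [← Real.exp_add]
        congr 2
        rw [hc]; ring

lemma enorm_gauss_sub_sq_le (ξ ζ : E d) :
    ‖gauss ζ - gauss ξ‖ₑ ^ 2 ≤ ENNReal.ofReal (gauss ζ) + ENNReal.ofReal (gauss ξ) := by
  rw [← ENNReal.ofReal_add (gauss_pos _).le (gauss_pos _).le, ← ofReal_norm,
    ← ENNReal.ofReal_pow (norm_nonneg _), Real.norm_eq_abs, sq_abs]
  refine ENNReal.ofReal_le_ofReal ?_
  nlinarith [gauss_pos ξ, gauss_pos ζ, gauss_le_one ξ, gauss_le_one ζ,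
    mul_pos (gauss_pos ξ) (gauss_pos ζ)]

lemma sobolevWeight_add_le (s : ℕ) (ξ η : E d) :
    sobolevWeight s (ξ + η) ≤ 2 ^ s * sobolevWeight s ξ * sobolevWeight s η := by
  have h2 : (2 : ℝ≥0∞) ^ s = ENNReal.ofReal (2 ^ s) := by
    rw [ENNReal.ofReal_pow (by norm_num)]; simp
  simp only [sobolevWeight]
  rw [h2, ← ENNReal.ofReal_mul (by positivity), ← ENNReal.ofReal_mul (by positivity), ← mul_pow,
    ← mul_pow]
  refine ENNReal.ofReal_le_ofReal (pow_le_pow_left₀ (by positivity) ?_ s)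
  have h := pow_le_pow_left₀ (norm_nonneg _) (norm_add_le ξ η) 2
  nlinarith [sq_nonneg (‖ξ‖ - ‖η‖), sq_nonneg (‖ξ‖ * ‖η‖)]

lemma one_le_sobolevWeight (s : ℕ) (η : E d) : 1 ≤ sobolevWeight s η := by
  rw [sobolevWeight, ENNReal.one_le_ofReal]
  exact one_le_pow₀ (by nlinarith [sq_nonneg ‖η‖])

lemma exists_oscWeight_le (d s : ℕ) :
    ∃ C : ℝ≥0∞, C ≠ ∞ ∧ ∀ η : E d, oscWeight s η ≤ C * sobolevWeight s η := by
  set A : ℝ≥0∞ := ∫⁻ ξ : E d, ENNReal.ofReal (gauss ξ) * sobolevWeight s ξ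
  have hAfin : A ≠ ∞ := (lintegral_exp_mul_sobolevWeight_lt_top Real.pi_pos s).ne
  have hmg : Measurable fun ξ : E d => ENNReal.ofReal (gauss ξ) :=
    ENNReal.measurable_ofReal.comp (continuous_gauss (d := d)).measurable
  refine ⟨2 ^ s * A + A, by finiteness, fun η => ?_⟩
  have h1 : ∫⁻ ξ : E d, ENNReal.ofReal (gauss (ξ - η)) * sobolevWeight s ξ ≤
      2 ^ s * A * sobolevWeight s η := by
    rw [← lintegral_add_right_eq_self _ η, mul_right_comm,
      ← lintegral_const_mul' _ _ (ENNReal.mul_ne_top (by simp) (sobolevWeight_ne_top _ _))]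
    refine lintegral_mono fun ξ => ?_
    rw [add_sub_cancel_right]
    calc _ ≤ ENNReal.ofReal (gauss ξ) * (2 ^ s * sobolevWeight s ξ * sobolevWeight s η) :=
          mul_le_mul_right (sobolevWeight_add_le s ξ η) _
      _ = _ := by ring
  calc oscWeight s η ≤ ∫⁻ ξ : E d, (ENNReal.ofReal (gauss (ξ - η)) * sobolevWeight s ξ +
        ENNReal.ofReal (gauss ξ) * sobolevWeight s ξ) := by
        refine lintegral_mono fun ξ => ?_
        rw [← add_mul]
        exact mul_le_mul_left (enorm_gauss_sub_sq_le _ _) _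
    _ ≤ 2 ^ s * A * sobolevWeight s η + A := by
        rw [lintegral_add_right (f := fun ξ => ENNReal.ofReal (gauss (ξ - η)) * sobolevWeight s ξ)
          (g := fun ξ => ENNReal.ofReal (gauss ξ) * sobolevWeight s ξ)
          (hmg.mul (measurable_sobolevWeight s))]
        exact add_le_add_left h1 _
    _ ≤ _ := by
        rw [add_mul]
        exact add_le_add_right (le_mul_of_one_le_right' (one_le_sobolevWeight s η)) _

lemma gauss_sub_le {ξ η : E d} (hη : ‖η‖ ≤ 1) :
    gauss (ξ - η) ≤ Real.exp Real.pi * Real.exp (-(Real.pi / 2 * ‖ξ‖ ^ 2)) := by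
  rw [gauss, ← Real.exp_add, Real.exp_le_exp]
  have h1 : ‖ξ‖ ≤ ‖ξ - η‖ + 1 := by
    calc ‖ξ‖ = ‖(ξ - η) + η‖ := by rw [sub_add_cancel]
      _ ≤ ‖ξ - η‖ + ‖η‖ := norm_add_le _ _
      _ ≤ _ := by gcongr
  have h2 : ‖ξ‖ ^ 2 ≤ 2 * ‖ξ - η‖ ^ 2 + 2 := by
    have := pow_le_pow_left₀ (norm_nonneg _) h1 2
    nlinarith [sq_nonneg (‖ξ - η‖ - 1)]
  nlinarith [Real.pi_pos]

lemma tendsto_oscWeight_zero (d s : ℕ) : Tendsto (oscWeight s : E d → ℝ≥0∞) (𝓝 0) (𝓝 0) := by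
  have hz : ∫⁻ ξ : E d, ‖gauss (ξ - 0) - gauss ξ‖ₑ ^ 2 * sobolevWeight s ξ = 0 := by simp
  rw [← hz]
  refine tendsto_lintegral_filter_of_dominated_convergence
    (fun ξ : E d => ENNReal.ofReal (2 * Real.exp Real.pi) *
      (ENNReal.ofReal (Real.exp (-(Real.pi / 2 * ‖ξ‖ ^ 2))) * sobolevWeight s ξ)) ?_ ?_ ?_ ?_
  · exact Eventually.of_forall fun η =>
      ((Continuous.measurable (by fun_prop)).enorm.pow_const 2).mul (measurable_sobolevWeight s)
  · filter_upwards [Metric.ball_mem_nhds (0 : E d) one_pos] with η hη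
    refine Eventually.of_forall fun ξ => ?_
    rw [← mul_assoc, ← ENNReal.ofReal_mul (by positivity)]
    refine mul_le_mul_left ((enorm_gauss_sub_sq_le _ _).trans ?_) _
    rw [← ENNReal.ofReal_add (gauss_pos _).le (gauss_pos _).le]
    refine ENNReal.ofReal_le_ofReal ?_
    have h1 := gauss_sub_le (ξ := ξ) (η := η) (by simpa using (mem_ball_zero_iff.1 hη).le)
    have h2 := gauss_sub_le (ξ := ξ) (η := 0) (by simp)
    rw [sub_zero] at h2
    linarith
  · rw [lintegral_const_mul' _ _ ENNReal.ofReal_ne_top]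
    exact ENNReal.mul_ne_top ENNReal.ofReal_ne_top
      (lintegral_exp_mul_sobolevWeight_lt_top (by positivity) s).ne
  · refine Eventually.of_forall fun ξ => ?_
    refine ENNReal.Tendsto.mul_const ?_ (Or.inr (sobolevWeight_ne_top _ _))
    refine Continuous.tendsto (f := fun η => ‖gauss (ξ - η) - gauss ξ‖ₑ ^ 2) ?_ 0
    fun_prop

/-- The weight `oscWeight` is small at low frequencies and bounded by `(1 + ‖η‖²)^s` at high ones,
up to a constant, so that a constant multiple of it is dominated by `1 / 2` plus a homogeneous weight of any order `k ≥ s`,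
with a scale `b` that does not depend on `k`. -/
lemma exists_oscWeight_le_half {s : ℕ} (hs : 1 ≤ s) {C : ℝ≥0∞} (hC : C ≠ ∞) :
    ∃ b : ℝ, 0 < b ∧ ∀ k, s ≤ k → ∀ η : E d,
      C * oscWeight s η ≤ ENNReal.ofReal (1 / 2 * (1 + (b * ‖η‖) ^ (2 * k))) := by
  obtain ⟨C₁, hC₁, hle⟩ := exists_oscWeight_le d s
  obtain ⟨a, ha, hsmall⟩ : ∃ a > 0, ∀ η : E d, ‖η‖ < a →
      C * oscWeight s η ≤ ENNReal.ofReal (1 / 2) := by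
    have h := ENNReal.Tendsto.const_mul (a := C) (tendsto_oscWeight_zero d s) (Or.inr hC)
    rw [mul_zero] at h
    have h' := h.eventually (Iio_mem_nhds (show (0 : ℝ≥0∞) < ENNReal.ofReal (1 / 2) by simp))
    obtain ⟨a, ha, h''⟩ := Metric.eventually_nhds_iff.1 h'
    exact ⟨a, ha, fun η hη => (h'' (by simpa using hη)).le⟩
  set D : ℝ := (C * C₁).toReal + 1 with hD
  have hD1 : 1 ≤ D := by simp only [hD, le_add_iff_nonneg_left]; positivity
  have hCD : C * C₁ ≤ ENNReal.ofReal D := by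
    rw [ENNReal.le_ofReal_iff_toReal_le (ENNReal.mul_ne_top hC hC₁) (by linarith)]
    simp [hD]
  -- this choice gives `2 D (1 + t) ≤ B t` for `t ≥ a²`, the range of high frequencies
  set B : ℝ := 2 * D * (1 / a ^ 2 + 1) with hB
  have hB0 : 0 < B := by positivity
  refine ⟨√B, Real.sqrt_pos.2 hB0, fun k hk η => ?_⟩
  have hpow : (√B * ‖η‖) ^ (2 * k) = (B * ‖η‖ ^ 2) ^ k := by
    rw [pow_mul, mul_pow, Real.sq_sqrt hB0.le]
  rw [hpow]
  rcases lt_or_ge ‖η‖ a with h | h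
  · refine (hsmall η h).trans (ENNReal.ofReal_le_ofReal ?_)
    have : 0 ≤ (B * ‖η‖ ^ 2) ^ k := by positivity
    linarith
  · have h1 : C * oscWeight s η ≤ ENNReal.ofReal (D * (1 + ‖η‖ ^ 2) ^ s) := by
      rw [ENNReal.ofReal_mul (by linarith)]
      calc _ ≤ C * (C₁ * sobolevWeight s η) := mul_le_mul_right (hle η) _
        _ ≤ _ := by
          rw [← mul_assoc]
          exact mul_le_mul_left hCD _
    refine h1.trans (ENNReal.ofReal_le_ofReal ?_)
    set t := ‖η‖ ^ 2
    have hat : a ^ 2 ≤ t := pow_le_pow_left₀ ha.le h 2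
    have ht : 1 + t ≤ (1 / a ^ 2 + 1) * t := by
      have : 1 ≤ 1 / a ^ 2 * t := by
        rw [one_div, inv_mul_eq_div, one_le_div (by positivity)]
        exact hat
      linarith
    have hBt : 2 * D * (1 + t) ≤ B * t := by
      rw [hB, mul_assoc (2 * D)]
      gcongr
    have ht0 : 0 ≤ t := by positivity
    have h2D : (2 * D) * (1 + t) ^ s ≤ (B * t) ^ k := by
      calc (2 * D) * (1 + t) ^ s ≤ (2 * D) ^ s * (1 + t) ^ s := by
            gcongr
            exact le_self_pow₀ (by linarith) (by omega)
        _ = (2 * D * (1 + t)) ^ s := (mul_pow _ _ _).symm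
        _ ≤ (2 * D * (1 + t)) ^ k := pow_le_pow_right₀ (by nlinarith) hk
        _ ≤ _ := pow_le_pow_left₀ (by positivity) hBt k
    linarith

/-- Sampling inequality at unit scale. The term `1 / 2` of `exists_oscWeight_le_half` is absorbed in
the left-hand side. -/
lemma lintegral_sq_le_of_vanishes_unit {s : ℕ} (hs : d < 2 * s) :
    ∃ b : ℝ, 0 < b ∧ ∀ F : E d → ℂ, StronglyMeasurable F → Integrable F → MemLp F 2 →
      ∀ X : Set (E d), (∀ x, ∃ y ∈ X, dist x y ≤ 1) → (∀ y ∈ X, 𝓕⁻ F y = 0) → ∀ k, s ≤ k →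
        ∫⁻ η, ‖F η‖ₑ ^ 2 ≤ ∫⁻ η, ‖F η‖ₑ ^ 2 * ENNReal.ofReal ((b * ‖η‖) ^ (2 * k)) := by
  obtain ⟨C, hC, hosc⟩ := exists_oscillation_bound hs
  obtain ⟨b, hb, hbk⟩ := exists_oscWeight_le_half (d := d) (show 1 ≤ s by omega) hC
  refine ⟨b, hb, fun F hF h1 h2 X hX h0 k hk => ?_⟩
  obtain ⟨M, hM, hle, hint⟩ := hosc F hF h1 h2
  set N := ∫⁻ η, ‖F η‖ₑ ^ 2 with hN
  set Y := ∫⁻ η, ‖F η‖ₑ ^ 2 * ENNReal.ofReal ((b * ‖η‖) ^ (2 * k))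
  have hF2 : Measurable fun η => ‖F η‖ₑ ^ 2 := hF.measurable.enorm.pow_const 2
  have hNfin : N ≠ ∞ := by
    have := h2.eLpNorm_lt_top
    rw [eLpNorm_eq_lintegral_rpow_enorm_toReal (by norm_num) (by norm_num)] at this
    have h3 := (ENNReal.rpow_lt_top_iff_of_pos (by norm_num)).1 this
    simpa [hN] using h3.ne
  have hNM : N ≤ ∫⁻ x, M x := by
    rw [hN, ← lintegral_fourierInv_sq h1 h2]
    refine lintegral_mono fun x => ?_
    obtain ⟨y, hy, hxy⟩ := hX x
    have := hle x (y - x) (by rwa [← dist_eq_norm, dist_comm])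
    rw [add_sub_cancel, h0 y hy, zero_sub, enorm_neg] at this
    exact this
  have half : ENNReal.ofReal (1 / 2) ≠ 0 := by simp
  have hmain : N ≤ ENNReal.ofReal (1 / 2) * N + ENNReal.ofReal (1 / 2) * Y := by
    calc N ≤ ∫⁻ η, ‖F η‖ₑ ^ 2 * (C * oscWeight s η) := by
          refine hNM.trans (hint.trans_eq ?_)
          rw [← lintegral_const_mul' _ _ hC]
          simp_rw [mul_left_comm]
      _ ≤ ∫⁻ η, (ENNReal.ofReal (1 / 2) * ‖F η‖ₑ ^ 2 + ENNReal.ofReal (1 / 2) *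
            (‖F η‖ₑ ^ 2 * ENNReal.ofReal ((b * ‖η‖) ^ (2 * k)))) := by
          refine lintegral_mono fun η => ?_
          refine (mul_le_mul_right (hbk k hk η) _).trans_eq ?_
          rw [ENNReal.ofReal_mul (by norm_num), ENNReal.ofReal_add (by norm_num) (by positivity),
            ENNReal.ofReal_one]
          ring
      _ = _ := by
          rw [lintegral_add_left (hF2.const_mul _), lintegral_const_mul' _ _ ENNReal.ofReal_ne_top,
            lintegral_const_mul' _ _ ENNReal.ofReal_ne_top]
  -- `N` is finite, so half of it can be subtracted on both sides of `hmain`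
  have hsplit : N = ENNReal.ofReal (1 / 2) * N + ENNReal.ofReal (1 / 2) * N := by
    rw [← add_mul, ← ENNReal.ofReal_add (by norm_num) (by norm_num)]
    norm_num
  have hfin : ENNReal.ofReal (1 / 2) * N ≠ ∞ := ENNReal.mul_ne_top ENNReal.ofReal_ne_top hNfin
  have : ENNReal.ofReal (1 / 2) * N ≤ ENNReal.ofReal (1 / 2) * Y :=
    (ENNReal.add_le_add_iff_left hfin).1 (hsplit ▸ hmain)
  exact (ENNReal.mul_le_mul_iff_right half ENNReal.ofReal_ne_top).1 this

lemma lintegral_comp_inv_smul {r : ℝ} (hr : 0 < r) (f : E d → ℝ≥0∞) :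
    ∫⁻ x, f (r⁻¹ • x) = ENNReal.ofReal (r ^ d) * ∫⁻ x, f x := by
  have hr' : r⁻¹ ≠ 0 := (inv_pos.2 hr).ne'
  rw [← (measurableEmbedding_const_smul₀ hr').lintegral_map f,
    Measure.map_addHaar_smul _ hr', lintegral_smul_measure, finrank_euclideanSpace_fin, inv_pow,
    inv_inv, abs_of_pos (pow_pos hr d), smul_eq_mul]

/-- Sampling inequality: if `f = 𝓕⁻ F` vanishes on a set that meets every closed ball of radius
`lam`, then its `L²` norm is controlled by homogeneous Sobolev norms of all large orders `k`, with
the same constant `b` for all of them. -/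
lemma exists_lintegral_sq_le_of_vanishes {s : ℕ} (hs : d < 2 * s) :
    ∃ b : ℝ, 0 < b ∧ ∀ F : E d → ℂ, StronglyMeasurable F → Integrable F → MemLp F 2 →
      ∀ lam : ℝ, 0 < lam → ∀ X : Set (E d), (∀ x, ∃ y ∈ X, dist x y ≤ lam) →
        (∀ y ∈ X, 𝓕⁻ F y = 0) → ∀ k, s ≤ k →
        ∫⁻ η, ‖F η‖ₑ ^ 2 ≤ ∫⁻ η, ‖F η‖ₑ ^ 2 * ENNReal.ofReal ((b * lam * ‖η‖) ^ (2 * k)) := by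
  obtain ⟨b, hb, hunit⟩ := lintegral_sq_le_of_vanishes_unit hs
  refine ⟨b, hb, fun F hF h1 h2 lam hlam X hX h0 k hk => ?_⟩
  have hl0 : lam⁻¹ ≠ 0 := (inv_pos.2 hlam).ne'
  have hm : Measurable fun η : E d => lam⁻¹ • η := measurable_const_smul _
  have i1 : Integrable fun η => F (lam⁻¹ • η) := h1.comp_smul hl0
  have i2 : MemLp (fun η => F (lam⁻¹ • η)) 2 := by
    refine (memLp_two_iff_integrable_sq_norm i1.aestronglyMeasurable).2 ?_
    exact ((memLp_two_iff_integrable_sq_norm h1.aestronglyMeasurable).1 h2).comp_smul hl0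
  have hfou : ∀ y, 𝓕⁻ (fun η => F (lam⁻¹ • η)) y = (lam ^ d : ℝ) • 𝓕⁻ F (lam • y) := by
    intro y
    rw [Real.fourierInv_eq, Real.fourierInv_eq]
    have := Measure.integral_comp_inv_smul_of_nonneg (volume : Measure (E d))
      (fun η => Real.fourierChar (inner ℝ η (lam • y)) • F η) hlam.le
    rw [finrank_euclideanSpace_fin] at this
    rw [← this]
    congr with η
    rw [inner_smul_left, inner_smul_right, ← mul_assoc]
    simp [inv_mul_cancel₀ hlam.ne']
  have key := hunit (fun η => F (lam⁻¹ • η)) (hF.comp_measurable hm) i1 i2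
    {y | lam • y ∈ X} (fun x => ?_) (fun y hy => ?_) k hk
  · have e : ∀ η : E d, ‖F (lam⁻¹ • η)‖ₑ ^ 2 * ENNReal.ofReal ((b * ‖η‖) ^ (2 * k)) =
        (fun ζ => ‖F ζ‖ₑ ^ 2 * ENNReal.ofReal ((b * lam * ‖ζ‖) ^ (2 * k))) (lam⁻¹ • η) := by
      intro η
      simp only [norm_smul, norm_inv, Real.norm_of_nonneg hlam.le]
      congr 3
      field_simp
    simp_rw [e] at key
    rw [lintegral_comp_inv_smul hlam (fun η => ‖F η‖ₑ ^ 2), lintegral_comp_inv_smul hlam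
      (fun ζ => ‖F ζ‖ₑ ^ 2 * ENNReal.ofReal ((b * lam * ‖ζ‖) ^ (2 * k)))] at key
    refine (ENNReal.mul_le_mul_iff_right ?_ ENNReal.ofReal_ne_top).1 key
    simpa using pow_pos hlam d
  · obtain ⟨y, hy, hxy⟩ := hX (lam • x)
    refine ⟨lam⁻¹ • y, by simpa [smul_smul, mul_inv_cancel₀ hlam.ne'] using hy, ?_⟩
    have : dist (lam • x) (lam • lam⁻¹ • y) ≤ lam := by
      simpa [smul_smul, mul_inv_cancel₀ hlam.ne'] using hxy
    rw [dist_smul₀, Real.norm_of_nonneg hlam.le] at this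
    exact le_of_mul_le_mul_left (by simpa using this) hlam
  · rw [hfou, h0 _ hy, smul_zero]

/-! ### Riesz sequences -/

section RieszSequence

variable {H ι : Type*} [NormedAddCommGroup H] [InnerProductSpace ℂ H]

/-- A family with a Bessel bound has a bounded analysis operator to `ℓ²`. -/
lemma exists_analysis_operator {e : ι → H} {C : ℝ}
    (hC : ∀ (g : H) (s : Finset ι), ∑ i ∈ s, ‖inner ℂ (e i) g‖ ^ 2 ≤ C * ‖g‖ ^ 2) :
    ∃ R : H →L[ℂ] lp (fun _ : ι => ℂ) 2, ∀ g i, R g i = inner ℂ (e i) g := by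
  have hmem : ∀ g : H, Memℓp (fun i => inner ℂ (e i) g) 2 := fun g => by
    refine (memℓp_gen_iff (by norm_num)).2 ?_
    refine summable_of_sum_le (c := C * ‖g‖ ^ 2) (fun i => by positivity) fun s => ?_
    simpa using hC g s
  let R₀ : H →ₗ[ℂ] lp (fun _ : ι => ℂ) 2 :=
    { toFun := fun g => ⟨fun i => inner ℂ (e i) g, hmem g⟩
      map_add' := fun g h => by ext i; exact inner_add_right _ _ _
      map_smul' := fun c g => by ext i; exact inner_smul_right _ _ _ }
  refine ⟨R₀.mkContinuous (√C) fun g => ?_, fun g i => rfl⟩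
  refine lp.norm_le_of_forall_sum_le (by norm_num) (by positivity) fun s => ?_
  have h : ∑ i ∈ s, ‖R₀ g i‖ ^ 2 ≤ C * ‖g‖ ^ 2 := hC g s
  rcases le_or_gt 0 C with h0 | h0
  · simpa [mul_pow, Real.sq_sqrt h0] using h
  · rw [Real.sqrt_eq_zero_of_nonpos h0.le]
    have : C * ‖g‖ ^ 2 ≤ 0 := mul_nonpos_of_nonpos_of_nonneg h0.le (by positivity)
    simpa using h.trans this

variable [CompleteSpace H]

/-- If `R` is the analysis operator of the family `e`, then its adjoint is the synthesis
operator. -/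
lemma hasSum_adjoint {e : ι → H} {R : H →L[ℂ] lp (fun _ : ι => ℂ) 2}
    (hR : ∀ g i, R g i = inner ℂ (e i) g) (α : lp (fun _ : ι => ℂ) 2) :
    HasSum (fun i => α i • e i) (R.adjoint α) := by
  classical
  have hsingle : ∀ i (a : ℂ), R.adjoint (lp.single 2 i a) = a • e i := by
    intro i a
    refine ext_inner_left ℂ fun g => ?_
    rw [ContinuousLinearMap.adjoint_inner_right, lp.inner_single_right, hR, inner_smul_right]
    simp
  have := (lp.hasSum_single (by norm_num) α).mapL R.adjoint
  simpa [hsingle] using this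

/-- If `e` also has a lower Riesz bound, then the Gram operator is invertible. -/
lemma isUnit_gram {e : ι → H} {R : H →L[ℂ] lp (fun _ : ι => ℂ) 2}
    (hR : ∀ g i, R g i = inner ℂ (e i) g) {c : ℝ} (hc : 0 < c)
    (hlow : ∀ (a : ι → ℂ) (s : Finset ι), c * ∑ i ∈ s, ‖a i‖ ^ 2 ≤ ‖∑ i ∈ s, a i • e i‖ ^ 2) :
    IsUnit (R ∘L R.adjoint) := by
  refine ContinuousLinearMap.isUnit_of_forall_le_norm_inner_map _ (c := ⟨c, hc.le⟩) hc fun α => ?_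
  have h1 : c * ‖α‖ ^ 2 ≤ ‖R.adjoint α‖ ^ 2 := by
    have hs1 : HasSum (fun i => ‖α i‖ ^ 2) (‖α‖ ^ 2) := by
      have := lp.hasSum_norm (p := 2) (by norm_num) α
      simpa using this
    have hs2 := hasSum_adjoint hR α
    exact le_of_tendsto_of_tendsto' (Tendsto.const_mul c hs1) ((hs2.norm).pow 2) fun s => hlow α s
  rw [ContinuousLinearMap.comp_apply, ← ContinuousLinearMap.adjoint_inner_right,
    inner_self_eq_norm_sq_to_K]
  refine le_of_eq_of_le (b := c * ‖α‖ ^ 2) (mul_comm _ _) (h1.trans_eq ?_)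
  simp

lemma exists_gram_inverse {e : ι → H} {R : H →L[ℂ] lp (fun _ : ι => ℂ) 2}
    (hR : ∀ g i, R g i = inner ℂ (e i) g) {c : ℝ} (hc : 0 < c)
    (hlow : ∀ (a : ι → ℂ) (s : Finset ι), c * ∑ i ∈ s, ‖a i‖ ^ 2 ≤ ‖∑ i ∈ s, a i • e i‖ ^ 2) :
    ∃ S : lp (fun _ : ι => ℂ) 2 →L[ℂ] lp (fun _ : ι => ℂ) 2,
      (∀ β, R (R.adjoint (S β)) = β) ∧ ∀ α, S (R (R.adjoint α)) = α := by
  obtain ⟨u, hu⟩ := isUnit_gram hR hc hlow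
  refine ⟨(↑u⁻¹ : _ →L[ℂ] _), fun β => ?_, fun α => ?_⟩
  · have := congrArg (fun f : lp (fun _ : ι => ℂ) 2 →L[ℂ] lp (fun _ : ι => ℂ) 2 => f β) u.mul_inv
    rw [hu] at this
    exact this
  · have := congrArg (fun f : lp (fun _ : ι => ℂ) 2 →L[ℂ] lp (fun _ : ι => ℂ) 2 => f α) u.inv_mul
    rw [hu] at this
    exact this

end RieszSequence

/-! ### Bessel potentials -/

/-- The symbol `|ξ|² + ε` of `Δ + ε` in the variable `w` with `ξ = 2 π w`. -/
noncomputable def besselSymbol (ε : ℝ) (w : E d) : ℝ := (2 * Real.pi) ^ 2 * ‖w‖ ^ 2 + ε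

/-- The symbol of `(Δ + ε)^(-k/2)`. -/
noncomputable def besselWeight (ε : ℝ) (k : ℕ) (w : E d) : ℝ := (√(besselSymbol ε w) ^ k)⁻¹

lemma besselSymbol_pos (hε : 0 < ε) (w : E d) : 0 < besselSymbol ε w := by
  unfold besselSymbol
  positivity

@[fun_prop]
lemma continuous_besselSymbol : Continuous (besselSymbol ε : E d → ℝ) := by
  unfold besselSymbol
  fun_prop

lemma besselWeight_pos (hε : 0 < ε) (k : ℕ) (w : E d) : 0 < besselWeight ε k w := by
  have := besselSymbol_pos hε w
  unfold besselWeight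
  positivity

lemma besselWeight_sq (hε : 0 < ε) (k : ℕ) (w : E d) :
    besselWeight ε k w ^ 2 = (besselSymbol ε w ^ k)⁻¹ := by
  rw [besselWeight, inv_pow, ← pow_mul, mul_comm, pow_mul, Real.sq_sqrt (besselSymbol_pos hε w).le]

lemma continuous_besselWeight (hε : 0 < ε) (k : ℕ) :
    Continuous (besselWeight ε k : E d → ℝ) := by
  unfold besselWeight
  refine Continuous.inv₀ (by fun_prop) fun w => ?_
  have := besselSymbol_pos hε w
  positivity

lemma besselWeight_le (hε : 0 < ε) (k : ℕ) (w : E d) : besselWeight ε k w ≤ (√ε ^ k)⁻¹ := by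
  unfold besselWeight
  have : √ε ≤ √(besselSymbol ε w) := by
    refine Real.sqrt_le_sqrt ?_
    unfold besselSymbol
    have : 0 ≤ (2 * Real.pi) ^ 2 * ‖w‖ ^ 2 := by positivity
    linarith
  have h0 := Real.sqrt_pos.2 hε
  gcongr

lemma one_add_norm_sq_le_besselSymbol (hε : 0 < ε) (w : E d) :
    1 + ‖w‖ ^ 2 ≤ (1 + 1 / ε) * besselSymbol ε w := by
  have h1 : ‖w‖ ^ 2 ≤ besselSymbol ε w := by
    have : (1 : ℝ) ≤ (2 * Real.pi) ^ 2 := by nlinarith [Real.pi_gt_three]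
    unfold besselSymbol
    nlinarith [sq_nonneg ‖w‖]
  have h2 : 1 ≤ 1 / ε * besselSymbol ε w := by
    rw [one_div, inv_mul_eq_div, one_le_div hε]
    unfold besselSymbol
    have : 0 ≤ (2 * Real.pi) ^ 2 * ‖w‖ ^ 2 := by positivity
    linarith
  linarith

lemma besselWeight_sq_le (hε : 0 < ε) (k : ℕ) (w : E d) :
    besselWeight ε k w ^ 2 ≤ (1 + 1 / ε) ^ k * ((1 + ‖w‖ ^ 2) ^ k)⁻¹ := by
  rw [besselWeight_sq hε]
  have h := pow_le_pow_left₀ (by positivity) (one_add_norm_sq_le_besselSymbol hε w) k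
  have hs := besselSymbol_pos hε w
  rw [← div_eq_mul_inv, le_div_iff₀ (by positivity), inv_mul_le_iff₀ (by positivity)]
  rwa [mul_pow, mul_comm] at h

lemma memLp_besselWeight (hε : 0 < ε) {k : ℕ} (hk : d < 2 * k) :
    MemLp (fun w : E d => (besselWeight ε k w : ℂ)) 2 := by
  have hc : Continuous fun w : E d => (besselWeight ε k w : ℂ) :=
    Complex.continuous_ofReal.comp (continuous_besselWeight hε k)
  rw [memLp_two_iff_integrable_sq_norm hc.aestronglyMeasurable]
  refine ((integrable_inv_one_add_norm_sq_pow hk).const_mul ((1 + 1 / ε) ^ k)).mono'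
    (hc.norm.pow 2).aestronglyMeasurable (Eventually.of_forall fun w => ?_)
  rw [Complex.norm_real, norm_pow, norm_norm, Real.norm_eq_abs, sq_abs]
  exact besselWeight_sq_le hε k w

lemma memLp_besselWeight_mul (hε : 0 < ε) (k : ℕ) {g : E d → ℂ} (hg : MemLp g 2) :
    MemLp (fun w => (besselWeight ε k w : ℂ) * g w) 2 := by
  have hc : Continuous fun w : E d => (besselWeight ε k w : ℂ) :=
    Complex.continuous_ofReal.comp (continuous_besselWeight hε k)
  refine MemLp.of_le_mul (c := (√ε ^ k)⁻¹) hg (hc.aestronglyMeasurable.mul hg.1)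
    (Eventually.of_forall fun w => ?_)
  rw [norm_mul, Complex.norm_real, Real.norm_of_nonneg (besselWeight_pos hε k w).le]
  gcongr
  exact besselWeight_le hε k w

lemma stronglyMeasurable_besselWeight_mul (hε : 0 < ε) (k : ℕ) (g : L2 d) :
    StronglyMeasurable (fun w => (besselWeight ε k w : ℂ) * g w) :=
  (Complex.continuous_ofReal.comp (continuous_besselWeight hε k)).stronglyMeasurable.mul
    (Lp.stronglyMeasurable g)

lemma integrable_besselWeight_mul (hε : 0 < ε) {k : ℕ} (hk : d < 2 * k) (g : L2 d) :
    Integrable (fun w => (besselWeight ε k w : ℂ) * g w) :=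
  (memLp_besselWeight hε hk).integrable_mul (Lp.memLp g)

/-- Multiplication by `besselWeight ε k` on `L²`. -/
noncomputable def besselMul (hε : 0 < ε) (k : ℕ) : L2 d →L[ℂ] L2 d :=
  LinearMap.mkContinuous
    { toFun := fun g => (memLp_besselWeight_mul hε k (Lp.memLp g)).toLp _
      map_add' := fun g h => by
        rw [← MemLp.toLp_add, MemLp.toLp_eq_toLp_iff]
        filter_upwards [Lp.coeFn_add g h] with w hw
        change (besselWeight ε k w : ℂ) * (g + h : L2 d) w = _ * g w + _ * h w
        rw [hw, Pi.add_apply, mul_add]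
      map_smul' := fun c g => by
        rw [RingHom.id_apply, ← MemLp.toLp_const_smul, MemLp.toLp_eq_toLp_iff]
        filter_upwards [Lp.coeFn_smul c g] with w hw
        change (besselWeight ε k w : ℂ) * (c • g : L2 d) w = c * (_ * g w)
        rw [hw, Pi.smul_apply, smul_eq_mul, mul_left_comm] }
    ((√ε ^ k)⁻¹) fun g => by
      refine Lp.norm_le_mul_norm_of_ae_le_mul ?_
      filter_upwards [MemLp.coeFn_toLp (memLp_besselWeight_mul hε k (Lp.memLp g))] with w hw
      simp only [LinearMap.coe_mk, AddHom.coe_mk]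
      rw [hw, norm_mul, Complex.norm_real, Real.norm_of_nonneg (besselWeight_pos hε k w).le]
      gcongr
      exact besselWeight_le hε k w

lemma coeFn_besselMul (hε : 0 < ε) (k : ℕ) (g : L2 d) :
    besselMul hε k g =ᵐ[volume] fun w => (besselWeight ε k w : ℂ) * g w :=
  MemLp.coeFn_toLp (memLp_besselWeight_mul hε k (Lp.memLp g))

lemma besselMul_eq_toLp (hε : 0 < ε) (k : ℕ) (g : L2 d) :
    besselMul hε k g = (memLp_besselWeight_mul hε k (Lp.memLp g)).toLp _ := rfl

/-- The continuous representative of `(Δ + ε)^(-k/2) (𝓕⁻ g)`. As `g` ranges over `L²`, this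
parametrizes the Sobolev space of order `k` isometrically. -/
noncomputable def besselPotential (ε : ℝ) (k : ℕ) (g : L2 d) : E d → ℂ :=
  𝓕⁻ (fun w => (besselWeight ε k w : ℂ) * g w)

lemma continuous_besselPotential (hε : 0 < ε) {k : ℕ} (hk : d < 2 * k) (g : L2 d) :
    Continuous (besselPotential ε k g) :=
  continuous_fourierInv (integrable_besselWeight_mul hε hk g)

lemma memLp_besselPotential (hε : 0 < ε) {k : ℕ} (hk : d < 2 * k) (g : L2 d) :
    MemLp (besselPotential ε k g) 2 :=
  (exists_toLp_fourierInv (integrable_besselWeight_mul hε hk g)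
    (memLp_besselWeight_mul hε k (Lp.memLp g))).choose

lemma toLp_besselPotential (hε : 0 < ε) {k : ℕ} (hk : d < 2 * k) (g : L2 d)
    (h : MemLp (besselPotential ε k g) 2) :
    h.toLp (besselPotential ε k g) = (𝓕⁻ (besselMul hε k g) : L2 d) :=
  (exists_toLp_fourierInv (integrable_besselWeight_mul hε hk g)
    (memLp_besselWeight_mul hε k (Lp.memLp g))).choose_spec

lemma memLp_besselEval (hε : 0 < ε) {k : ℕ} (hk : d < 2 * k) (x : E d) :
    MemLp (fun w : E d => Real.fourierChar (-inner ℝ w x) • (besselWeight ε k w : ℂ)) 2 := by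
  refine (memLp_besselWeight hε hk).mono ?_ (Eventually.of_forall fun w => ?_)
  · exact (Continuous.aestronglyMeasurable (by fun_prop)).smul (memLp_besselWeight hε hk).1
  · rw [Circle.norm_smul]

/-- The vector of `L²` that represents evaluation at `x` of a Bessel potential. -/
noncomputable def besselEval (hε : 0 < ε) {k : ℕ} (hk : d < 2 * k) (x : E d) : L2 d :=
  (memLp_besselEval hε hk x).toLp _

lemma inner_besselEval (hε : 0 < ε) {k : ℕ} (hk : d < 2 * k) (x : E d) (g : L2 d) :
    inner ℂ (besselEval hε hk x) g = besselPotential ε k g x := by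
  rw [L2.inner_def, besselPotential, Real.fourierInv_eq]
  refine integral_congr_ae ?_
  filter_upwards [(memLp_besselEval hε hk x).coeFn_toLp] with w hw
  rw [besselEval, hw]
  simp only [RCLike.inner_apply, Circle.smul_def, smul_eq_mul, map_mul, Complex.conj_ofReal,
    AddChar.map_neg_eq_inv, Circle.coe_inv_eq_conj, Complex.conj_conj]
  ring

/-- The reproducing kernel is the fundamental solution; the change of variables `ξ = 2 π w` produces
the factor `(2 π)^(-d)`. -/
lemma besselPotential_besselEval (hε : 0 < ε) {k : ℕ} (hk : d < 2 * k) (x y : E d) :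
    besselPotential ε k (besselEval hε hk y) x = fundamentalSolution ε k (x - y) := by
  have hpi : (0 : ℝ) < 2 * Real.pi := by positivity
  rw [besselPotential, fundamentalSolution, Real.fourierInv_eq']
  have := Measure.integral_comp_smul_of_nonneg (volume : Measure (E d))
    (fun ξ : E d => Complex.exp (Complex.I * ((inner ℝ ξ (x - y) : ℝ) : ℂ)) /
      (((‖ξ‖ ^ 2 + ε) ^ k : ℝ) : ℂ)) (2 * Real.pi) (hR := hpi.le)
  rw [finrank_euclideanSpace_fin, Complex.real_smul] at this
  push_cast at this ⊢
  rw [inv_pow, ← this]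
  refine integral_congr_ae ?_
  filter_upwards [(memLp_besselEval hε hk y).coeFn_toLp] with w hw
  have hsq : ((besselWeight ε k w : ℝ) : ℂ) * (besselWeight ε k w : ℂ) =
      ((((2 * Real.pi * ‖w‖) ^ 2 + ε) ^ k : ℝ) : ℂ)⁻¹ := by
    rw [← Complex.ofReal_mul, ← sq, besselWeight_sq hε, Complex.ofReal_inv, besselSymbol,
      mul_pow (2 * Real.pi)]
  have hassoc : ∀ a u v : ℂ, u * (a * (v * a)) = (u * v) * (a * a) := fun a u v => by ring
  rw [besselEval, hw, Circle.smul_def, Real.fourierChar_apply, smul_eq_mul, smul_eq_mul,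
    hassoc, hsq, ← Complex.exp_add, ← div_eq_mul_inv]
  rw [norm_smul, Real.norm_of_nonneg hpi.le, inner_smul_left, inner_sub_right]
  push_cast
  congr 2
  simp only [conj_trivial]
  push_cast
  ring

/-! ### Evaluation at the points of a separated set -/

/-- If a function `h` is at least `c γ` near each point `γ` of a separated set, then the sum of the
`c γ` is controlled by the integral of `h`. -/
lemma sum_mul_volume_ball_le {X : Set (E d)} {δ ρ : ℝ} (hρ : 2 * ρ ≤ δ)
    (hX : ∀ x ∈ X, ∀ y ∈ X, x ≠ y → δ ≤ dist x y) (h : E d → ℝ≥0∞) (c : X → ℝ≥0∞)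
    (s : Finset X) (hc : ∀ γ ∈ s, ∀ y ∈ Metric.ball (γ : E d) ρ, c γ ≤ h y) :
    (∑ γ ∈ s, c γ) * volume (Metric.ball (0 : E d) ρ) ≤ ∫⁻ y, h y := by
  have hd : Set.PairwiseDisjoint (s : Set X) fun γ => Metric.ball (γ : E d) ρ := by
    intro γ _ μ _ hne
    refine Metric.ball_disjoint_ball ?_
    have := hX γ γ.2 μ μ.2 (fun h => hne (Subtype.ext h))
    linarith
  calc (∑ γ ∈ s, c γ) * volume (Metric.ball (0 : E d) ρ)
      = ∑ γ ∈ s, ∫⁻ _ in Metric.ball (γ : E d) ρ, c γ := by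
        rw [Finset.sum_mul]
        refine Finset.sum_congr rfl fun γ _ => ?_
        rw [setLIntegral_const, Measure.addHaar_ball_center _ (γ : E d)]
    _ ≤ ∑ γ ∈ s, ∫⁻ y in Metric.ball (γ : E d) ρ, h y :=
        Finset.sum_le_sum fun γ hγ => setLIntegral_mono' measurableSet_ball (hc γ hγ)
    _ = ∫⁻ y in ⋃ γ ∈ s, Metric.ball (γ : E d) ρ, h y :=
        (lintegral_biUnion_finset hd (fun _ _ => measurableSet_ball) h).symm
    _ ≤ _ := setLIntegral_le_lintegral _ _

lemma ennreal_add_sq_le (a b : ℝ≥0∞) : (a + b) ^ 2 ≤ 4 * (a ^ 2 + b ^ 2) := by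
  have key : ∀ a b : ℝ≥0∞, a ≤ b → (a + b) ^ 2 ≤ 4 * (a ^ 2 + b ^ 2) := fun a b h => by
    calc (a + b) ^ 2 ≤ (b + b) ^ 2 := pow_le_pow_left' (add_le_add_left h b) 2
      _ = 4 * b ^ 2 := by ring
      _ ≤ _ := mul_le_mul_right le_add_self _
  rcases le_total a b with h | h
  · exact key a b h
  · rw [add_comm a b, add_comm (a ^ 2)]
    exact key b a h

lemma enorm_besselWeight_mul_sq_mul_le (hε : 0 < ε) (k : ℕ) (w : E d) (z : ℂ) :
    ‖(besselWeight ε k w : ℂ) * z‖ₑ ^ 2 * sobolevWeight k w ≤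
      ENNReal.ofReal ((1 + 1 / ε) ^ k) * ‖z‖ₑ ^ 2 := by
  rw [enorm_mul, mul_pow, mul_right_comm]
  refine mul_le_mul_left ?_ _
  rw [← ofReal_norm, ← ENNReal.ofReal_pow (norm_nonneg _), Complex.norm_real, Real.norm_eq_abs,
    sq_abs, sobolevWeight, ← ENNReal.ofReal_mul (by positivity)]
  refine ENNReal.ofReal_le_ofReal ?_
  have := besselWeight_sq_le hε k w
  rwa [← div_eq_mul_inv, le_div_iff₀ (by positivity)] at this

/-- Bessel bound: the values of Bessel potentials at the points of a separated set are square
summable. -/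
lemma exists_bessel_bound (hε : 0 < ε) {k : ℕ} (hk : d < 2 * k) {X : Set (E d)} {δ : ℝ}
    (hδ : 0 < δ) (hX : ∀ x ∈ X, ∀ y ∈ X, x ≠ y → δ ≤ dist x y) :
    ∃ C : ℝ, ∀ (g : L2 d) (s : Finset X),
      ∑ γ ∈ s, ‖inner ℂ (besselEval hε hk (γ : E d)) g‖ ^ 2 ≤ C * ‖g‖ ^ 2 := by
  obtain ⟨C, hC, hosc⟩ := exists_oscillation_bound hk
  obtain ⟨C₁, hC₁, hle⟩ := exists_oscWeight_le d k
  set ρ := min 1 (δ / 2)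
  have hρ : 0 < ρ := by positivity
  have hρδ : 2 * ρ ≤ δ := by
    have : ρ ≤ δ / 2 := min_le_right _ _
    linarith
  set V := volume (Metric.ball (0 : E d) ρ)
  have hV0 : V ≠ 0 := (Metric.measure_ball_pos _ _ hρ).ne'
  have hVtop : V ≠ ∞ := measure_ball_lt_top.ne
  set A : ℝ≥0∞ := 4 * (1 + C * C₁) * ENNReal.ofReal ((1 + 1 / ε) ^ k) with hA
  have hAtop : A ≠ ∞ := by finiteness
  refine ⟨(A / V).toReal, fun g s => ?_⟩
  set F : E d → ℂ := fun w => (besselWeight ε k w : ℂ) * g w with hF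
  have hFm : StronglyMeasurable F := stronglyMeasurable_besselWeight_mul hε k g
  have h1 : Integrable F := integrable_besselWeight_mul hε hk g
  have h2 : MemLp F 2 := memLp_besselWeight_mul hε k (Lp.memLp g)
  obtain ⟨M, hM, hMle, hMint⟩ := hosc F hFm h1 h2
  have hF2 : Measurable fun w => ‖F w‖ₑ ^ 2 := hFm.measurable.enorm.pow_const 2
  have hu : Measurable fun x => ‖𝓕⁻ F x‖ₑ ^ 2 :=
    (continuous_fourierInv h1).measurable.enorm.pow_const 2
  have hsum := sum_mul_volume_ball_le hρδ hX (fun y => 4 * (‖𝓕⁻ F y‖ₑ ^ 2 + M y))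
    (fun γ => ‖𝓕⁻ F (γ : E d)‖ₑ ^ 2) s (fun γ _ y hy => by
      have hd : ‖(γ : E d) - y‖ ≤ 1 := by
        rw [← dist_eq_norm, dist_comm]
        exact (Metric.mem_ball.1 hy).le.trans (min_le_left _ _)
      have h := hMle y (γ - y) hd
      rw [add_sub_cancel] at h
      calc ‖𝓕⁻ F (γ : E d)‖ₑ ^ 2 ≤ (‖𝓕⁻ F y‖ₑ + ‖𝓕⁻ F (γ : E d) - 𝓕⁻ F y‖ₑ) ^ 2 := by
            refine pow_le_pow_left' ?_ 2
            calc _ = ‖𝓕⁻ F y + (𝓕⁻ F (γ : E d) - 𝓕⁻ F y)‖ₑ := by rw [add_sub_cancel]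
              _ ≤ _ := enorm_add_le _ _
        _ ≤ 4 * (‖𝓕⁻ F y‖ₑ ^ 2 + ‖𝓕⁻ F (γ : E d) - 𝓕⁻ F y‖ₑ ^ 2) := ennreal_add_sq_le _ _
        _ ≤ _ := mul_le_mul_right (add_le_add_right h _) _)
  have hbound : ∫⁻ y, 4 * (‖𝓕⁻ F y‖ₑ ^ 2 + M y) ≤ A * ‖g‖ₑ ^ 2 := by
    rw [lintegral_const_mul' _ _ (by simp), lintegral_add_left hu, lintegral_fourierInv_sq h1 h2]
    calc _ ≤ 4 * ((∫⁻ w, ‖F w‖ₑ ^ 2) + C * ∫⁻ w, ‖F w‖ₑ ^ 2 * oscWeight k w) :=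
          mul_le_mul_right (add_le_add_right hMint _) _
      _ = 4 * ∫⁻ w, (‖F w‖ₑ ^ 2 + C * (‖F w‖ₑ ^ 2 * oscWeight k w)) := by
          rw [lintegral_add_left hF2, lintegral_const_mul' _ _ hC]
      _ ≤ 4 * ∫⁻ w, (1 + C * C₁) * ENNReal.ofReal ((1 + 1 / ε) ^ k) * ‖g w‖ₑ ^ 2 := by
          refine mul_le_mul_right (lintegral_mono fun w => ?_) _
          calc ‖F w‖ₑ ^ 2 + C * (‖F w‖ₑ ^ 2 * oscWeight k w)
              ≤ ‖F w‖ₑ ^ 2 * sobolevWeight k w +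
                C * (‖F w‖ₑ ^ 2 * (C₁ * sobolevWeight k w)) := by
                refine add_le_add (le_mul_of_one_le_right' (one_le_sobolevWeight k w)) ?_
                exact mul_le_mul_right (mul_le_mul_right (hle w) _) _
            _ = (1 + C * C₁) * (‖F w‖ₑ ^ 2 * sobolevWeight k w) := by ring
            _ ≤ (1 + C * C₁) * (ENNReal.ofReal ((1 + 1 / ε) ^ k) * ‖g w‖ₑ ^ 2) :=
                mul_le_mul_right (enorm_besselWeight_mul_sq_mul_le hε k w (g w)) _
            _ = _ := by ring
      _ = _ := by
          rw [lintegral_const_mul' _ _ (by finiteness), lintegral_enorm_sq, hA]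
          ring
  have hfin : ∑ γ ∈ s, ‖𝓕⁻ F (γ : E d)‖ₑ ^ 2 ≤ A / V * ‖g‖ₑ ^ 2 := by
    have := hsum.trans hbound
    rw [div_eq_mul_inv, mul_right_comm, ← div_eq_mul_inv,
      ENNReal.le_div_iff_mul_le (Or.inl hV0) (Or.inl hVtop)]
    exact this
  have hreal := ENNReal.toReal_mono (ENNReal.mul_ne_top (ENNReal.div_ne_top hAtop hV0) (by simp))
    hfin
  rw [ENNReal.toReal_sum (by simp), ENNReal.toReal_mul] at hreal
  simpa [inner_besselEval, besselPotential, hF] using hreal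

/-- A Schwartz function is dominated by every Bessel weight. -/
lemma exists_norm_le_besselWeight (hε : 0 < ε) (k : ℕ) (Ψ : 𝓢(E d, ℂ)) :
    ∃ A : ℝ, 0 < A ∧ ∀ w, ‖Ψ w‖ ≤ A * besselWeight ε k w := by
  set A₀ : ℝ := 2 ^ k * (Finset.Iic (k, 0)).sup (fun m => SchwartzMap.seminorm ℂ m.1 m.2) Ψ
  set B := 2 * Real.pi + √ε
  have hB : 0 < B := by positivity
  have hdecay : ∀ w, (1 + ‖w‖) ^ k * ‖Ψ w‖ ≤ A₀ := fun w => by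
    simpa using SchwartzMap.one_add_le_sup_seminorm_apply (𝕜 := ℂ) (m := (k, 0)) le_rfl le_rfl Ψ w
  have hA₀ : 0 ≤ A₀ := le_trans (by positivity) (hdecay 0)
  refine ⟨B ^ k * A₀ + 1, by positivity, fun w => ?_⟩
  have hs := Real.sqrt_pos.2 (besselSymbol_pos hε w)
  rw [besselWeight, ← div_eq_mul_inv, le_div_iff₀ (by positivity)]
  have hsq : √(besselSymbol ε w) ≤ B * (1 + ‖w‖) := by
    refine Real.sqrt_le_iff.2 ⟨by positivity, ?_⟩
    have h1 : 0 ≤ √ε * ‖w‖ := by positivity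
    have h2 : 2 * Real.pi * ‖w‖ + √ε ≤ B * (1 + ‖w‖) := by
      simp only [B]
      nlinarith [Real.pi_pos]
    calc besselSymbol ε w ≤ (2 * Real.pi * ‖w‖ + √ε) ^ 2 := by
          have : 0 ≤ 2 * Real.pi * ‖w‖ * √ε := by positivity
          rw [besselSymbol, add_sq, Real.sq_sqrt hε.le]
          linarith [mul_pow (2 * Real.pi) ‖w‖ 2]
      _ ≤ _ := pow_le_pow_left₀ (by positivity) h2 2
  calc ‖Ψ w‖ * √(besselSymbol ε w) ^ k ≤ ‖Ψ w‖ * (B * (1 + ‖w‖)) ^ k := by gcongr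
    _ = B ^ k * ((1 + ‖w‖) ^ k * ‖Ψ w‖) := by rw [mul_pow]; ring
    _ ≤ B ^ k * A₀ := by gcongr; exact hdecay w
    _ ≤ _ := by linarith

lemma coeFn_sum_besselEval (hε : 0 < ε) {k : ℕ} (hk : d < 2 * k) {X : Set (E d)} (a : X → ℂ)
    (s : Finset X) :
    (∑ γ ∈ s, a γ • besselEval hε hk (γ : E d) : L2 d) =ᵐ[volume] fun w =>
      (∑ γ ∈ s, a γ * Real.fourierChar (-inner ℝ w (γ : E d))) * besselWeight ε k w := by
  classical
  induction s using Finset.induction_on with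
  | empty =>
    filter_upwards [Lp.coeFn_zero ℂ 2 (volume : Measure (E d))] with w hw
    simp only [Finset.sum_empty, zero_mul]
    exact hw
  | insert γ s hγ ih =>
    rw [Finset.sum_insert hγ]
    filter_upwards [ih, Lp.coeFn_add (a γ • besselEval hε hk (γ : E d))
      (∑ γ ∈ s, a γ • besselEval hε hk (γ : E d)), Lp.coeFn_smul (a γ)
      (besselEval hε hk (γ : E d)), (memLp_besselEval hε hk (γ : E d)).coeFn_toLp]
      with w h1 h2 h3 h4
    rw [h2, Pi.add_apply, h3, Pi.smul_apply, h1, besselEval, h4, Finset.sum_insert hγ, add_mul,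
      smul_eq_mul, Circle.smul_def, smul_eq_mul, mul_assoc]

/-- The inverse Fourier transform of an exponential sum times `𝓕 φ` is a superposition of translates
of `φ`. -/
lemma fourierInv_sum_char_mul {X : Set (E d)} (a : X → ℂ) (s : Finset X) (φ : 𝓢(E d, ℂ))
    (x : E d) :
    𝓕⁻ (fun w => (∑ γ ∈ s, a γ * Real.fourierChar (-inner ℝ w (γ : E d))) *
      (𝓕 φ : 𝓢(E d, ℂ)) w) x = ∑ γ ∈ s, a γ * φ (x - γ) := by
  have hinv : ∀ y, ∫ w : E d, Real.fourierChar (inner ℝ w y) • (𝓕 φ : 𝓢(E d, ℂ)) w = φ y := by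
    intro y
    rw [← Real.fourierInv_eq, ← SchwartzMap.fourierInv_coe, FourierTransform.fourierInv_fourier_eq]
  have hint : ∀ y, Integrable fun w : E d =>
      Real.fourierChar (inner ℝ w y) • (𝓕 φ : 𝓢(E d, ℂ)) w := fun y => by
    have := (Real.fourierIntegral_convergent_iff (μ := volume) (-y)).2
      (𝓕 φ : 𝓢(E d, ℂ)).integrable
    simpa using this
  rw [Real.fourierInv_eq]
  calc _ = ∫ w : E d, ∑ γ ∈ s, a γ * (Real.fourierChar (inner ℝ w (x - γ)) •
        (𝓕 φ : 𝓢(E d, ℂ)) w) := by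
        congr with w
        rw [Finset.sum_mul, Finset.smul_sum]
        refine Finset.sum_congr rfl fun γ _ => ?_
        rw [inner_sub_right, sub_eq_add_neg, AddChar.map_add_eq_mul]
        simp only [Circle.smul_def, smul_eq_mul, Circle.coe_mul]
        ring
    _ = _ := by
        rw [integral_finsetSum _ fun γ _ => (hint _).const_mul _]
        simp_rw [integral_const_mul, hinv]

/-- A smooth bump that equals `1` near the origin and is supported in a small ball. -/
lemma exists_schwartz_bump {δ : ℝ} (hδ : 0 < δ) :
    ∃ φ : 𝓢(E d, ℂ), (∀ x, ‖x‖ ≤ δ / 4 → φ x = 1) ∧ ∀ x, δ / 2 ≤ ‖x‖ → φ x = 0 := by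
  let f : ContDiffBump (0 : E d) := ⟨δ / 4, δ / 2, by positivity, by linarith⟩
  have hc : HasCompactSupport (Complex.ofRealCLM ∘ f) := f.hasCompactSupport.comp_left rfl
  have hs : ContDiff ℝ (↑(⊤ : ℕ∞)) (Complex.ofRealCLM ∘ f) :=
    Complex.ofRealCLM.contDiff.comp f.contDiff
  refine ⟨hc.toSchwartzMap hs, fun x hx => ?_, fun x hx => ?_⟩
  · have : f x = 1 := f.one_of_mem_closedBall (by simpa using hx)
    simp [this]
  · have : f x = 0 := f.zero_of_le_dist (by simpa using hx)
    simp [this]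

/-- Lower Riesz bound: the evaluation vectors at the points of a separated set are stably linearly
independent. The weight of the exponential sum is compared with the Fourier transform of a bump
whose translates to the points of the set have disjoint supports. -/
lemma exists_riesz_lower_bound (hε : 0 < ε) {k : ℕ} (hk : d < 2 * k) {X : Set (E d)} {δ : ℝ}
    (hδ : 0 < δ) (hX : ∀ x ∈ X, ∀ y ∈ X, x ≠ y → δ ≤ dist x y) :
    ∃ c : ℝ, 0 < c ∧ ∀ (a : X → ℂ) (s : Finset X),
      c * ∑ γ ∈ s, ‖a γ‖ ^ 2 ≤ ‖∑ γ ∈ s, a γ • besselEval hε hk (γ : E d)‖ ^ 2 := by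
  obtain ⟨φ, hφ1, hφ0⟩ := exists_schwartz_bump (d := d) hδ
  set Ψ : 𝓢(E d, ℂ) := 𝓕 φ
  obtain ⟨A, hA, hΨA⟩ := exists_norm_le_besselWeight hε k Ψ
  set V := volume (Metric.ball (0 : E d) (δ / 4))
  have hV0 : V ≠ 0 := (Metric.measure_ball_pos _ _ (by positivity)).ne'
  have hVtop : V ≠ ∞ := measure_ball_lt_top.ne
  have hVpos : 0 < V.toReal := ENNReal.toReal_pos hV0 hVtop
  refine ⟨V.toReal / A ^ 2, by positivity, fun a s => ?_⟩
  set P : E d → ℂ := fun w => ∑ γ ∈ s, a γ * Real.fourierChar (-inner ℝ w (γ : E d))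
  have hPc : Continuous P := by
    refine continuous_finsetSum _ fun γ _ => continuous_const.mul ?_
    exact continuous_induced_dom.comp (by fun_prop)
  have hPb : ∀ w, ‖P w‖ ≤ ∑ γ ∈ s, ‖a γ‖ := fun w =>
    (norm_sum_le _ _).trans_eq (Finset.sum_congr rfl fun γ _ => by
      rw [norm_mul, Circle.norm_coe, mul_one])
  have i1 : Integrable fun w => P w * Ψ w :=
    Ψ.integrable.bdd_mul hPc.aestronglyMeasurable (Eventually.of_forall hPb)
  have i2 : MemLp (fun w => P w * Ψ w) 2 := by
    refine MemLp.of_le_mul (c := ∑ γ ∈ s, ‖a γ‖) (Ψ.memLp 2 volume) i1.aestronglyMeasurable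
      (Eventually.of_forall fun w => ?_)
    rw [norm_mul]
    gcongr
    exact hPb w
  have hsum := sum_mul_volume_ball_le (ρ := δ / 4) (by linarith) hX
    (fun y => ‖𝓕⁻ (fun w => P w * Ψ w) y‖ₑ ^ 2) (fun γ => ‖a γ‖ₑ ^ 2) s (fun γ hγ y hy => by
      rw [fourierInv_sum_char_mul, Finset.sum_eq_single_of_mem γ hγ, hφ1, mul_one]
      · rw [← dist_eq_norm]
        exact (Metric.mem_ball.1 hy).le
      · intro μ _ hne
        rw [hφ0, mul_zero]
        have h1 := hX μ μ.2 γ γ.2 fun h => hne (Subtype.ext h)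
        have h2 := dist_triangle (μ : E d) y γ
        have h3 := Metric.mem_ball.1 hy
        rw [← dist_eq_norm, dist_comm]
        linarith)
  have hle : ∫⁻ w, ‖P w * Ψ w‖ₑ ^ 2 ≤
      ENNReal.ofReal (A ^ 2) * ‖∑ γ ∈ s, a γ • besselEval hε hk (γ : E d)‖ₑ ^ 2 := by
    rw [← lintegral_enorm_sq, ← lintegral_const_mul' _ _ ENNReal.ofReal_ne_top]
    refine lintegral_mono_ae ?_
    filter_upwards [coeFn_sum_besselEval hε hk a s] with w hw
    rw [hw, ENNReal.ofReal_pow hA.le, ← mul_pow]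
    refine pow_le_pow_left' ?_ 2
    rw [← ofReal_norm, ← ofReal_norm, ← ENNReal.ofReal_mul hA.le]
    refine ENNReal.ofReal_le_ofReal ?_
    rw [norm_mul, norm_mul, Complex.norm_real, Real.norm_of_nonneg (besselWeight_pos hε k w).le,
      mul_left_comm]
    exact mul_le_mul_of_nonneg_left (hΨA w) (norm_nonneg _)
  rw [lintegral_fourierInv_sq i1 i2] at hsum
  have hreal := ENNReal.toReal_mono (by finiteness) (hsum.trans hle)
  rw [ENNReal.toReal_mul, ENNReal.toReal_mul, ENNReal.toReal_sum (by simp),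
    ENNReal.toReal_ofReal (by positivity)] at hreal
  simp only [ENNReal.toReal_pow, toReal_enorm] at hreal
  rw [div_mul_eq_mul_div, div_le_iff₀ (by positivity)]
  linarith

/-! ### The operator `Δ + ε` on tempered distributions -/

lemma hasTemperateGrowth_besselSymbol :
    (fun w : E d => (besselSymbol ε w : ℂ)).HasTemperateGrowth := by
  unfold besselSymbol
  fun_prop

lemma hasTemperateGrowth_inv_besselSymbol (hε : 0 < ε) :
    (fun w : E d => (((besselSymbol ε w)⁻¹ : ℝ) : ℂ)).HasTemperateGrowth := by
  set a := 2 * Real.pi / √ε with ha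
  have h1 : (fun w : E d => (1 + ‖a • w‖ ^ 2) ^ (-1 : ℝ)).HasTemperateGrowth :=
    (Function.hasTemperateGrowth_one_add_norm_sq_rpow (E d) (-1)).comp
      (a • ContinuousLinearMap.id ℝ (E d)).hasTemperateGrowth
  have h2 : (fun w : E d => (besselSymbol ε w)⁻¹) =
      fun w => ε⁻¹ * (1 + ‖a • w‖ ^ 2) ^ (-1 : ℝ) := by
    ext w
    rw [Real.rpow_neg_one, ← mul_inv, norm_smul, mul_pow, Real.norm_eq_abs, sq_abs, ha, div_pow,
      Real.sq_sqrt hε.le, besselSymbol]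
    congr 1
    field_simp
    ring
  have h3 : (fun w : E d => (besselSymbol ε w)⁻¹).HasTemperateGrowth := by
    rw [h2]
    fun_prop
  fun_prop

lemma opD_eq_fourierMultiplier (T : 𝓢'(E d, ℂ)) :
    opD ε T = TemperedDistribution.fourierMultiplierCLM ℂ
      (fun w : E d => (besselSymbol ε w : ℂ)) T := by
  have h : (fun w : E d => (besselSymbol ε w : ℂ)) =
      ((((2 * Real.pi) ^ 2 : ℝ) : ℂ) • fun w : E d => ((‖w‖ ^ 2 : ℝ) : ℂ)) + fun _ => (ε : ℂ) := by
    ext w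
    simp [besselSymbol]
  have h1 : (fun w : E d => ((‖w‖ ^ 2 : ℝ) : ℂ)).HasTemperateGrowth := by fun_prop
  have h2 : ((((2 * Real.pi) ^ 2 : ℝ) : ℂ) •
      fun w : E d => ((‖w‖ ^ 2 : ℝ) : ℂ)).HasTemperateGrowth := by
    have : (fun w : E d =>
        (((2 * Real.pi) ^ 2 : ℝ) : ℂ) * ((‖w‖ ^ 2 : ℝ) : ℂ)).HasTemperateGrowth := by fun_prop
    exact this
  rw [h, TemperedDistribution.fourierMultiplierCLM_apply,
    TemperedDistribution.smulLeftCLM_add h2 (by fun_prop),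
    TemperedDistribution.smulLeftCLM_smul h1, opD,
    TemperedDistribution.laplacian_eq_fourierMultiplierCLM,
    TemperedDistribution.fourierMultiplierCLM_apply]
  simp only [add_apply, smul_apply,
    FourierTransform.fourierInv_add, FourierTransform.fourierInv_smul,
    TemperedDistribution.smulLeftCLM_const, FourierTransform.fourierInv_fourier_eq, neg_smul,
    sub_neg_eq_add]
  rw [add_comm, Complex.coe_smul]

lemma opD_iterate_eq_fourierMultiplier (k : ℕ) (T : 𝓢'(E d, ℂ)) :
    (opD ε)^[k] T = TemperedDistribution.fourierMultiplierCLM ℂ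
      (fun w : E d => ((besselSymbol ε w : ℂ)) ^ k) T := by
  induction k with
  | zero => simp
  | succ k ih =>
    have h := hasTemperateGrowth_besselSymbol (d := d) (ε := ε)
    rw [Function.iterate_succ_apply', ih, opD_eq_fourierMultiplier,
      TemperedDistribution.fourierMultiplierCLM_fourierMultiplierCLM_apply (by fun_prop) h]
    congr 2

lemma opD_injective (hε : 0 < ε) : Function.Injective (opD ε : 𝓢'(E d, ℂ) → 𝓢'(E d, ℂ)) := by
  refine Function.LeftInverse.injective (g := TemperedDistribution.fourierMultiplierCLM ℂ
      (fun w : E d => (((besselSymbol ε w)⁻¹ : ℝ) : ℂ))) fun T => ?_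
  rw [opD_eq_fourierMultiplier, TemperedDistribution.fourierMultiplierCLM_fourierMultiplierCLM_apply
    hasTemperateGrowth_besselSymbol (hasTemperateGrowth_inv_besselSymbol hε)]
  have : ((fun w : E d => (besselSymbol ε w : ℂ)) *
      fun w : E d => (((besselSymbol ε w)⁻¹ : ℝ) : ℂ)) = fun _ => 1 := by
    ext w
    have := (besselSymbol_pos hε w).ne'
    simp [this]
  rw [this, TemperedDistribution.fourierMultiplierCLM_const]
  simp

/-- The distribution `(Δ + ε)^k (𝓕⁻ (besselMul g))`, formally `(Δ + ε)^(k/2) (𝓕⁻ g)`, as a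
continuous linear function of `g`. -/
noncomputable def besselSource (hε : 0 < ε) (k : ℕ) : L2 d →L[ℂ] 𝓢'(E d, ℂ) :=
  TemperedDistribution.fourierMultiplierCLM ℂ (fun w : E d => ((besselSymbol ε w : ℂ)) ^ k) ∘L
    Lp.toTemperedDistributionCLM ℂ volume 2 ∘L
    (Lp.fourierTransformₗᵢ (E d) ℂ).symm.toContinuousLinearEquiv.toContinuousLinearMap ∘L
    besselMul hε k

lemma besselSource_apply (hε : 0 < ε) (k : ℕ) (g : L2 d) :
    besselSource hε k g = (opD ε)^[k] ((𝓕⁻ (besselMul hε k g) : L2 d) : 𝓢'(E d, ℂ)) := by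
  rw [opD_iterate_eq_fourierMultiplier]
  rfl

/-- The equation `(Δ + ε)^k E = δ` for the fundamental solution `E` and its translates. -/
lemma besselSource_besselEval (hε : 0 < ε) {k : ℕ} (hk : d < 2 * k) (x : E d) :
    besselSource hε k (besselEval hε hk x) = TemperedDistribution.delta x := by
  ext φ
  have hg : (fun w : E d => ((besselSymbol ε w : ℂ)) ^ k).HasTemperateGrowth := by
    have := hasTemperateGrowth_besselSymbol (d := d) (ε := ε)
    fun_prop
  rw [besselSource_apply, opD_iterate_eq_fourierMultiplier,
    TemperedDistribution.fourierMultiplierCLM_apply_apply,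
    ← Lp.fourierInv_toTemperedDistribution_eq, TemperedDistribution.fourierInv_apply,
    FourierTransform.fourierInv_fourier_eq, Lp.toTemperedDistribution_apply,
    TemperedDistribution.delta_apply]
  have hφ : φ x = ∫ w : E d, Real.fourierChar (-inner ℝ w x) • (𝓕⁻ φ : 𝓢(E d, ℂ)) w := by
    rw [← Real.fourier_eq, ← SchwartzMap.fourier_coe, FourierTransform.fourier_fourierInv_eq]
  rw [hφ]
  refine integral_congr_ae ?_
  filter_upwards [coeFn_besselMul hε k (besselEval hε hk x),
    (memLp_besselEval hε hk x).coeFn_toLp] with w h1 h2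
  rw [h1, besselEval, h2, SchwartzMap.smulLeftCLM_apply_apply hg]
  have hsq : (besselSymbol ε w : ℂ) ^ k * ((besselWeight ε k w : ℂ) * besselWeight ε k w) = 1 := by
    rw [← Complex.ofReal_mul, ← sq, besselWeight_sq hε, ← Complex.ofReal_pow, ← Complex.ofReal_mul,
      mul_inv_cancel₀ (pow_pos (besselSymbol_pos hε w) k).ne', Complex.ofReal_one]
  simp only [Circle.smul_def, smul_eq_mul]
  calc _ = (besselSymbol ε w : ℂ) ^ k * ((besselWeight ε k w : ℂ) * besselWeight ε k w) *
        (Real.fourierChar (-inner ℝ w x) * (𝓕⁻ φ : 𝓢(E d, ℂ)) w) := by ring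
    _ = _ := by rw [hsq, one_mul]

/-! ### Lagrangian splines -/

/-- For every `(α_γ)` in `ℓ²`, the Bessel potential of `∑ α_γ e_γ` is a spline. -/
lemma isSpline_besselPotential (hε : 0 < ε) {k : ℕ} (hk : d < 2 * k) {X : Set (E d)}
    {α : lp (fun _ : X => ℂ) 2} {g : L2 d}
    (hg : HasSum (fun γ : X => α γ • besselEval hε hk (γ : E d)) g) :
    IsSpline ε X k (besselPotential ε k g) where
  continuous := continuous_besselPotential hε hk g
  memLp := memLp_besselPotential hε hk g
  equation := by
    refine ⟨α, ?_⟩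
    rw [toLp_besselPotential hε hk, ← besselSource_apply]
    have := hg.mapL (besselSource hε k)
    simpa [besselSource_besselEval] using this

/-- Conversely, the spline equation determines the spline. -/
lemma eq_besselPotential_of_hasSum (hε : 0 < ε) {k : ℕ} (hk : d < 2 * k) {X : Set (E d)}
    {α : lp (fun _ : X => ℂ) 2} {g : L2 d}
    (hg : HasSum (fun γ : X => α γ • besselEval hε hk (γ : E d)) g) {u : E d → ℂ}
    (hc : Continuous u) (hu : MemLp u 2)
    (heq : HasSum (fun γ : X => α γ • TemperedDistribution.delta (γ : E d))
      ((opD ε)^[k] ((hu.toLp u : L2 d) : 𝓢'(E d, ℂ)))) :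
    u = besselPotential ε k g := by
  have h1 := hg.mapL (besselSource hε k)
  simp only [map_smul, besselSource_besselEval] at h1
  have h2 := heq.unique h1
  rw [besselSource_apply, ← toLp_besselPotential hε hk g (memLp_besselPotential hε hk g)] at h2
  have h3 := (opD_injective hε).iterate k h2
  have h4 : (hu.toLp u : L2 d) = (memLp_besselPotential hε hk g).toLp _ :=
    LinearMap.ker_eq_bot.1 (Lp.ker_toTemperedDistributionCLM_eq_bot (F := ℂ)
      (μ := (volume : Measure (E d))) (p := 2)) h3
  exact (hc.ae_eq_iff_eq volume (continuous_besselPotential hε hk g)).1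
    ((MemLp.toLp_eq_toLp_iff _ _).1 h4)

lemma hasSum_fundamentalSolution (hε : 0 < ε) {k : ℕ} (hk : d < 2 * k) {X : Set (E d)}
    {α : lp (fun _ : X => ℂ) 2} {g : L2 d}
    (hg : HasSum (fun γ : X => α γ • besselEval hε hk (γ : E d)) g) (x : E d) :
    HasSum (fun γ : X => α γ * fundamentalSolution ε k (x - (γ : E d)))
      (besselPotential ε k g x) := by
  have := hg.mapL (innerSL ℂ (besselEval hε hk x))
  simpa [inner_besselEval, besselPotential_besselEval, inner_smul_right] using this

/-- The Lagrangian splines of a separated set exist and are unique. Moreover, the data of any Bessel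
potential `g` are interpolated by `∑_ν g(ν) L_ν`, which is the Bessel potential of the projection
`p` of `g` to the space of splines. -/
theorem exists_lagrangianSplines (hε : 0 < ε) {k : ℕ} (hk : d < 2 * k) {X : Set (E d)} {δ : ℝ}
    (hδ : 0 < δ) (hX : ∀ x ∈ X, ∀ y ∈ X, x ≠ y → δ ≤ dist x y) :
    ∃ (L : X → E d → ℂ) (hL : ∀ ν, IsLagrangianSpline ε X k ν (L ν)),
      (∀ ν u, IsLagrangianSpline ε X k ν u → u = L ν) ∧
      (∀ ν, ∃ a : lp (fun _ : X => ℂ) 2, ∀ x : E d,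
        HasSum (fun μ : X => a μ * fundamentalSolution ε k (x - (μ : E d))) (L ν x)) ∧
      ∀ g : L2 d, ∃ p : L2 d,
        HasSum (fun ν : X => besselPotential ε k g ν • (hL ν).memLp.toLp (L ν))
          (𝓕⁻ (besselMul hε k p) : L2 d) ∧
        (∀ ν : X, besselPotential ε k (g - p) ν = 0) ∧ inner ℂ (g - p) p = 0 := by
  classical
  obtain ⟨C, hC⟩ := exists_bessel_bound hε hk hδ hX
  obtain ⟨c, hc, hlow⟩ := exists_riesz_lower_bound hε hk hδ hX
  obtain ⟨R, hR⟩ := exists_analysis_operator hC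
  obtain ⟨S, hS1, hS2⟩ := exists_gram_inverse hR hc hlow
  have hsyn := fun α => hasSum_adjoint hR α
  have heval : ∀ (g : L2 d) (μ : X), besselPotential ε k g μ = R g μ := fun g μ => by
    rw [hR, inner_besselEval]
  set q : X → L2 d := fun ν => R.adjoint (S (lp.single 2 ν 1)) with hq
  have hspl : ∀ ν, IsSpline ε X k (besselPotential ε k (q ν)) := fun ν =>
    isSpline_besselPotential hε hk (hsyn _)
  have hL : ∀ ν, IsLagrangianSpline ε X k ν (besselPotential ε k (q ν)) := fun ν =>
    { hspl ν with
      apply_knot := fun μ => by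
        rw [heval, hq]
        simp only [hS1, lp.single_apply, Pi.single_apply] }
  refine ⟨fun ν => besselPotential ε k (q ν), hL, fun ν u hu => ?_, fun ν => ?_, fun g => ?_⟩
  · obtain ⟨α, hα⟩ := hu.equation
    have hu' := eq_besselPotential_of_hasSum hε hk (hsyn α) hu.continuous hu.memLp hα
    have hRα : R (R.adjoint α) = lp.single 2 ν 1 := by
      ext μ
      rw [← heval, ← hu', hu.apply_knot μ]
      simp [lp.single_apply, Pi.single_apply]
    have hSα : α = S (lp.single 2 ν 1) := by rw [← hRα, hS2]
    rw [hu', hq, hSα]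
  · exact ⟨S (lp.single 2 ν 1), fun x => hasSum_fundamentalSolution hε hk (hsyn _) x⟩
  · have hzero : R (g - R.adjoint (S (R g))) = 0 := by rw [map_sub, hS1, sub_self]
    refine ⟨R.adjoint (S (R g)), ?_, fun ν => ?_, ?_⟩
    · have h1 := (lp.hasSum_single (by norm_num) (R g)).mapL
        ((Lp.fourierTransformₗᵢ (E d) ℂ).symm.toContinuousLinearEquiv.toContinuousLinearMap ∘L
          besselMul hε k ∘L R.adjoint ∘L S)
      convert h1 using 2 with ν
      · have hs : lp.single 2 ν (R g ν) =
            R g ν • lp.single (E := fun _ : X => ℂ) 2 ν (1 : ℂ) := by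
          rw [← lp.single_smul, smul_eq_mul, mul_one]
        rw [heval, toLp_besselPotential hε hk, hs, map_smul]
        rfl
      · rfl
    · rw [heval, hzero]
      rfl
    · rw [ContinuousLinearMap.adjoint_inner_right, hzero, inner_zero_left]

/-! ### Error estimate for band-limited functions -/

/-- The knots of `X(lam)` are `lam`-dense. -/
lemma IsKnotSet.exists_dist_le {lam : ℝ} (hlam : 0 ≤ lam) {X : Set (E d)} (hX : IsKnotSet lam X)
    (x : E d) : ∃ y ∈ X, dist x y ≤ lam := by
  obtain ⟨Q, -, hknot, -, hdiam, -, hcover⟩ := hX.exists_cells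
  obtain ⟨γ, hγ⟩ := Set.mem_iUnion.1 (hcover ▸ Set.mem_univ x)
  have hγQ : (γ : E d) ∈ Q γ := by
    have : (γ : E d) ∈ Q γ ∩ X := by rw [hknot]; rfl
    exact this.1
  refine ⟨γ, γ.2, ?_⟩
  have h := (Metric.edist_le_ediam_of_mem hγ (subset_closure hγQ)).trans
    ((Metric.ediam_closure (Q γ)).le.trans (hdiam γ))
  rwa [edist_dist, ENNReal.ofReal_le_ofReal_iff hlam] at h

lemma besselWeight_sq_mul_pow_le (hε : 0 < ε) (k : ℕ) {q : ℝ} (w : E d) :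
    besselWeight ε k w ^ 2 * (q * (2 * Real.pi * ‖w‖)) ^ (2 * k) ≤ q ^ (2 * k) := by
  rw [besselWeight_sq hε, mul_pow, mul_left_comm]
  refine mul_le_of_le_one_right ((even_two_mul k).pow_nonneg q) ?_
  rw [inv_mul_le_one₀ (pow_pos (besselSymbol_pos hε w) k), pow_mul]
  refine pow_le_pow_left₀ (by positivity) ?_ k
  rw [besselSymbol, mul_pow (2 * Real.pi)]
  linarith

/-- Sampling inequality for the Bessel potentials that vanish on a dense enough set. -/
lemma exists_norm_besselMul_le {s : ℕ} (hs : d < 2 * s) :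
    ∃ c : ℝ, 0 < c ∧ ∀ ε : ℝ, ∀ hε : 0 < ε, ∀ lam : ℝ, 0 < lam → ∀ X : Set (E d),
      (∀ x, ∃ y ∈ X, dist x y ≤ lam) → ∀ k, s ≤ k → ∀ h : L2 d,
        (∀ y ∈ X, besselPotential ε k h y = 0) → ‖besselMul hε k h‖ ≤ (c * lam) ^ k * ‖h‖ := by
  obtain ⟨b, hb, hmain⟩ := exists_lintegral_sq_le_of_vanishes hs
  refine ⟨b / (2 * Real.pi), by positivity, fun ε hε lam hlam X hX k hk h h0 => ?_⟩
  set q := b / (2 * Real.pi) * lam with hq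
  have hq0 : 0 < q := by positivity
  have key := hmain _ (stronglyMeasurable_besselWeight_mul hε k h)
    (integrable_besselWeight_mul hε (by omega) h) (memLp_besselWeight_mul hε k (Lp.memLp h))
    lam hlam X hX h0 k hk
  have hle : ‖besselMul hε k h‖ₑ ^ 2 ≤ ENNReal.ofReal (q ^ (2 * k)) * ‖h‖ₑ ^ 2 := by
    rw [besselMul_eq_toLp, ← lintegral_enorm_sq_toLp, ← lintegral_enorm_sq h,
      ← lintegral_const_mul' _ _ ENNReal.ofReal_ne_top]
    refine key.trans (lintegral_mono fun w => ?_)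
    rw [enorm_mul, mul_pow, mul_right_comm]
    refine mul_le_mul_left ?_ _
    rw [← ofReal_norm, ← ENNReal.ofReal_pow (norm_nonneg _), Complex.norm_real, Real.norm_eq_abs,
      sq_abs, ← ENNReal.ofReal_mul (by positivity)]
    refine ENNReal.ofReal_le_ofReal ?_
    have hbq : b * lam * ‖w‖ = q * (2 * Real.pi * ‖w‖) := by
      rw [hq]
      field_simp
    rw [hbq]
    exact besselWeight_sq_mul_pow_le hε k w
  have hreal := ENNReal.toReal_mono (by finiteness) hle
  rw [ENNReal.toReal_mul, ENNReal.toReal_ofReal (by positivity)] at hreal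
  simp only [ENNReal.toReal_pow, toReal_enorm] at hreal
  refine le_of_sq_le_sq ?_ (by positivity)
  rw [mul_pow, ← pow_mul, mul_comm k 2]
  exact hreal

/-- On the spectrum of a band-limited function the operator `(Δ + ε)^(m/2)` is bounded. -/
lemma IsBandLimited.exists_sqrt_besselSymbol_pow_mul {σ : ℝ} {f : E d → ℂ}
    (hf : IsBandLimited σ f) (m : ℕ) :
    ∃ g : L2 d, (g =ᵐ[volume] fun w => ((√(besselSymbol ε w) ^ m : ℝ) : ℂ) *
        (𝓕 (hf.memLp.toLp f : L2 d) : L2 d) w) ∧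
      ‖g‖ ≤ √(σ ^ 2 + ε) ^ m * ‖(hf.memLp.toLp f : L2 d)‖ := by
  set F : L2 d := 𝓕 (hf.memLp.toLp f : L2 d)
  have hbound : ∀ᵐ w, ‖((√(besselSymbol ε w) ^ m : ℝ) : ℂ) * F w‖ ≤
      √(σ ^ 2 + ε) ^ m * ‖F w‖ := by
    filter_upwards [hf.fourier_eq_zero] with w hw
    rcases lt_or_ge σ (2 * Real.pi * ‖w‖) with h | h
    · have : F w = 0 := hw h
      simp [this]
    · rw [norm_mul, Complex.norm_real, Real.norm_of_nonneg (by positivity)]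
      have h1 : besselSymbol ε w ≤ σ ^ 2 + ε := by
        have := pow_le_pow_left₀ (by positivity) h 2
        rw [besselSymbol, ← mul_pow]
        linarith
      gcongr
  have hm : AEStronglyMeasurable (fun w => ((√(besselSymbol ε w) ^ m : ℝ) : ℂ) * F w) := by
    refine AEStronglyMeasurable.mul ?_ (Lp.aestronglyMeasurable F)
    exact (Complex.continuous_ofReal.comp (by fun_prop)).aestronglyMeasurable
  have hmem : MemLp (fun w => ((√(besselSymbol ε w) ^ m : ℝ) : ℂ) * F w) 2 :=
    MemLp.of_le_mul (Lp.memLp F) hm hbound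
  refine ⟨hmem.toLp _, hmem.coeFn_toLp, ?_⟩
  have hn : ‖(hf.memLp.toLp f : L2 d)‖ = ‖F‖ := (Lp.norm_fourier_eq _).symm
  rw [hn]
  refine Lp.norm_le_mul_norm_of_ae_le_mul ?_
  filter_upwards [hmem.coeFn_toLp, hbound] with w h1 h2
  rwa [h1]

/-- A band-limited function is a Bessel potential of every order. Pairing with its density `g`
costs only the `L²` norm of the Bessel potential of the other factor. -/
lemma IsBandLimited.exists_besselPotential_eq (hε : 0 < ε) {k : ℕ} (hk : d < 2 * k) {σ : ℝ}
    {f : E d → ℂ} (hf : IsBandLimited σ f) :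
    ∃ g : L2 d, f = besselPotential ε k g ∧
      ∀ h : L2 d, ‖inner ℂ h g‖ ≤
        (σ ^ 2 + ε) ^ k * ‖besselMul hε k h‖ * ‖(hf.memLp.toLp f : L2 d)‖ := by
  obtain ⟨g, hg, -⟩ := hf.exists_sqrt_besselSymbol_pow_mul (ε := ε) k
  obtain ⟨G, hG, hGn⟩ := hf.exists_sqrt_besselSymbol_pow_mul (ε := ε) (2 * k)
  have hwt : ∀ w : E d, √(besselSymbol ε w) ^ k * besselWeight ε k w = 1 := fun w => by
    have := Real.sqrt_pos.2 (besselSymbol_pos hε w)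
    rw [besselWeight, mul_inv_cancel₀ (by positivity)]
  refine ⟨g, ?_, fun h => ?_⟩
  · refine (hf.continuous.ae_eq_iff_eq volume (continuous_besselPotential hε hk g)).1 ?_
    rw [← MemLp.toLp_eq_toLp_iff hf.memLp (memLp_besselPotential hε hk g),
      toLp_besselPotential hε hk]
    have : besselMul hε k g = 𝓕 (hf.memLp.toLp f : L2 d) := by
      refine Lp.ext ?_
      filter_upwards [coeFn_besselMul hε k g, hg] with w h1 h2
      rw [h1, h2, ← mul_assoc, ← Complex.ofReal_mul, mul_comm (besselWeight ε k w), hwt,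
        Complex.ofReal_one, one_mul]
    rw [this, FourierTransform.fourierInv_fourier_eq]
  · have hin : inner ℂ h g = inner ℂ (besselMul hε k h) G := by
      rw [L2.inner_def, L2.inner_def]
      refine integral_congr_ae ?_
      filter_upwards [coeFn_besselMul hε k h, hg, hG] with w h1 h2 h3
      rw [h1, h2, h3]
      simp only [RCLike.inner_apply, map_mul, Complex.conj_ofReal]
      have e : ((√(besselSymbol ε w) ^ (2 * k) : ℝ) : ℂ) * besselWeight ε k w =
          ((√(besselSymbol ε w) ^ k : ℝ) : ℂ) := by
        rw [← Complex.ofReal_mul, two_mul, pow_add, mul_assoc, hwt, mul_one]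
      rw [← e]
      ring
    rw [hin]
    refine (norm_inner_le_norm _ _).trans ?_
    rw [pow_mul, Real.sq_sqrt (by positivity)] at hGn
    calc _ ≤ ‖besselMul hε k h‖ * ((σ ^ 2 + ε) ^ k * ‖(hf.memLp.toLp f : L2 d)‖) := by gcongr
      _ = _ := by ring

/-- Duality argument of Aubin–Nitsche type. Here `J` is `besselMul`, the interpolation error `f - s`
has density `g - p`, and `hsamp` is the sampling inequality; since `‖g - p‖²` is the pairing of
`g - p` with `g`, that inequality is used twice, which doubles the order of approximation. -/
lemma norm_besselMul_sub_le {H : Type*} [NormedAddCommGroup H] [InnerProductSpace ℂ H]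
    {J : H →L[ℂ] H} {g p : H} {A B N : ℝ} (hA : 0 ≤ A) (horth : inner ℂ (g - p) p = 0)
    (hsamp : ‖J (g - p)‖ ≤ A * ‖g - p‖) (hpair : ‖inner ℂ (g - p) g‖ ≤ B * ‖J (g - p)‖ * N)
    (hBN : 0 ≤ B * N) : ‖J (g - p)‖ ≤ A ^ 2 * B * N := by
  have h1 : ‖g - p‖ ^ 2 ≤ A * (B * N) * ‖g - p‖ := by
    have : inner ℂ (g - p) g = ((‖g - p‖ ^ 2 : ℝ) : ℂ) := by
      have h := inner_self_eq_norm_sq_to_K (𝕜 := ℂ) (g - p)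
      rw [inner_sub_right, horth, sub_zero] at h
      rw [h]
      norm_cast
    rw [this, Complex.norm_real, Real.norm_of_nonneg (by positivity)] at hpair
    calc _ ≤ _ := hpair
      _ = B * N * ‖J (g - p)‖ := by ring
      _ ≤ B * N * (A * ‖g - p‖) := by gcongr
      _ = _ := by ring
  have h2 : ‖g - p‖ ≤ A * (B * N) := by
    rcases eq_or_lt_of_le (norm_nonneg (g - p)) with h | h
    · rw [← h]; positivity
    · rw [sq] at h1
      exact le_of_mul_le_mul_right h1 h
  calc _ ≤ _ := hsamp
    _ ≤ A * (A * (B * N)) := by gcongr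
    _ = _ := by ring

end IrregularSampling

theorem theorem2p1 (d : ℕ) (ε : ℝ) (hε : 0 < ε) :
    ∃ c : ℝ, 0 < c ∧
      ∀ (σ : ℝ), 0 < σ →
      ∀ (lam : ℝ), 0 < lam → lam < ((σ + ε) * c)⁻¹ →
      ∀ (X : Set (E d)), IsKnotSet lam X →
      ∀ (r : ℕ), d / 2 + 1 ≤ r →
        -- the Lagrangian splines `L_ν^(2^l r)` exist, are unique, and are linear combinations of
        -- translates of the fundamental solution
        ∃ (L : ℕ → X → E d → ℂ)
          (hL : ∀ (l : ℕ) (ν : X), IsLagrangianSpline ε X (2 ^ l * r) ν (L l ν)),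
          (∀ (l : ℕ) (ν : X) (u : E d → ℂ),
            IsLagrangianSpline ε X (2 ^ l * r) ν u → u = L l ν) ∧
          (∀ (l : ℕ) (ν : X), ∃ a : lp (fun _ : X => ℂ) 2, ∀ x : E d,
            HasSum (fun μ : X => a μ * fundamentalSolution ε (2 ^ l * r) (x - (μ : E d))) (L l ν x)) ∧
          -- the sampling series converge in `L²`, and their sums `s l` tend to `f` in `L²`
          ∀ (f : E d → ℂ) (hf : IsBandLimited σ f),
            ∃ s : ℕ → L2 d,
              (∀ l : ℕ, HasSum (fun ν : X => f ν • (hL l ν).memLp.toLp (L l ν)) (s l)) ∧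
              Tendsto s atTop (𝓝 (hf.memLp.toLp f)) ∧
              ∀ l : ℕ, ‖hf.memLp.toLp f - s l‖ ≤
                2 * (c * lam * (σ + ε)) ^ (2 ^ (l + 1) * r) * ‖hf.memLp.toLp f‖ := by
  obtain ⟨c₀, hc₀, hsamp⟩ := exists_norm_besselMul_le (d := d) (s := d / 2 + 1) (by omega)
  -- the factor `√(1 + 1 / ε)` turns `√(σ ^ 2 + ε)` into `σ + ε`
  set c := c₀ * √(1 + 1 / ε) with hc
  refine ⟨c, by positivity, fun σ hσ lam hlam hlamc X hX r hr => ?_⟩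
  have hr1 : 1 ≤ r := by omega
  have hk : ∀ l : ℕ, d / 2 + 1 ≤ 2 ^ l * r := fun l =>
    hr.trans (Nat.le_mul_of_pos_left r (by positivity))
  have hdk : ∀ l : ℕ, d < 2 * (2 ^ l * r) := fun l => by
    have := hk l
    omega
  obtain ⟨δ, hδ, hsep⟩ := hX.separated
  choose L hL huniq hrep hint using fun l => exists_lagrangianSplines hε (hdk l) hδ hsep
  refine ⟨L, hL, huniq, hrep, fun f hf => ?_⟩
  set N := ‖(hf.memLp.toLp f : L2 d)‖
  set q := c * lam * (σ + ε) with hq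
  have hq0 : 0 ≤ q := by positivity
  have hq1 : q < 1 := by
    rw [lt_inv_comm₀ hlam (by positivity), lt_inv_comm₀ (by positivity) hlam, ← one_div,
      lt_div_iff₀ (by positivity)] at hlamc
    rw [hq]
    linarith
  choose g hfg hpair using fun l => hf.exists_besselPotential_eq hε (hdk l)
  choose p hsum hzero horth using fun l => hint l (g l)
  have herr : ∀ l, ‖hf.memLp.toLp f - (𝓕⁻ (besselMul hε (2 ^ l * r) (p l)) : L2 d)‖ ≤
      2 * q ^ (2 ^ (l + 1) * r) * N := by
    intro l
    set k := 2 ^ l * r with hkdef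
    have hfJ : hf.memLp.toLp f = (𝓕⁻ (besselMul hε k (g l)) : L2 d) := by
      rw [← toLp_besselPotential hε (hdk l) _ (memLp_besselPotential hε (hdk l) _)]
      exact MemLp.toLp_congr _ _ (Eventually.of_forall fun x => congrFun (hfg l) x)
    have hnorm : ‖hf.memLp.toLp f - (𝓕⁻ (besselMul hε k (p l)) : L2 d)‖ =
        ‖besselMul hε k (g l - p l)‖ := by
      rw [hfJ, map_sub]
      have := (Lp.fourierTransformₗᵢ (E d) ℂ).symm.norm_map
        (besselMul hε k (g l) - besselMul hε k (p l))
      rw [map_sub] at this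
      exact this
    have hA := hsamp ε hε lam hlam X (hX.exists_dist_le hlam.le) k (hk l) (g l - p l)
      fun y hy => hzero l ⟨y, hy⟩
    have hE := norm_besselMul_sub_le (by positivity) (horth l) hA (hpair l (g l - p l))
      (by positivity)
    have hle : (c₀ * lam) ^ 2 * (σ ^ 2 + ε) ≤ q ^ 2 := by
      have h1 : σ ^ 2 + ε ≤ (1 + 1 / ε) * (σ + ε) ^ 2 := by
        have h2 : ε ≤ 1 / ε * (σ + ε) ^ 2 := by
          rw [one_div, inv_mul_eq_div, le_div_iff₀ hε]
          nlinarith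
        nlinarith
      calc _ ≤ (c₀ * lam) ^ 2 * ((1 + 1 / ε) * (σ + ε) ^ 2) := by gcongr
        _ = _ := by
          rw [hq, hc, mul_pow, mul_pow, mul_pow, mul_pow, Real.sq_sqrt (by positivity)]
          ring
    have hpow : ((c₀ * lam) ^ k) ^ 2 * (σ ^ 2 + ε) ^ k ≤ q ^ (2 ^ (l + 1) * r) := by
      have e : 2 ^ (l + 1) * r = 2 * k := by rw [hkdef, pow_succ]; ring
      rw [e, pow_mul q, ← pow_mul, mul_comm k 2, pow_mul, ← mul_pow]
      exact pow_le_pow_left₀ (by positivity) hle k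
    rw [hnorm]
    calc _ ≤ _ := hE
      _ ≤ q ^ (2 ^ (l + 1) * r) * N := by gcongr
      _ ≤ _ := by
        rw [mul_assoc]
        exact le_mul_of_one_le_left (by positivity) (by norm_num)
  refine ⟨fun l => 𝓕⁻ (besselMul hε (2 ^ l * r) (p l)), fun l => ?_, ?_, herr⟩
  · have := hsum l
    rwa [← hfg l] at this
  · have hexp : Tendsto (fun l : ℕ => 2 ^ (l + 1) * r) atTop atTop := by
      refine tendsto_atTop_mono (fun l => ?_) tendsto_id
      exact (Nat.lt_two_pow_self.trans_le (Nat.pow_le_pow_right two_pos l.le_succ)).le.trans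
        (Nat.le_mul_of_pos_right _ hr1)
    have hlim := ((tendsto_pow_atTop_nhds_zero_of_lt_one hq0 hq1).comp hexp).const_mul 2
      |>.mul_const N
    rw [mul_zero, zero_mul] at hlim
    rw [tendsto_iff_norm_sub_tendsto_zero]
    refine squeeze_zero (fun l => norm_nonneg _) (fun l => ?_) hlim
    rw [norm_sub_rev]
    exact herr l
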